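/- For a finite non-abelian group $G$ let $\Gamma_G$ be its commuting conjugacy class graph: the vertices are the conjugacy classes of the non-central elements of $G$, and two distinct classes $x^G,y^G$ are adjacent iff some $x'\in x^G$ and $y'\in y^G$ commute. For a finite graph $\mathcal G$ on vertices $v_1,\dots,v_N$ ($N \ge 1$) let $CN(\mathcal G)$ be the $N\times N$ matrix whose $(i,j)$ entry is the number of common neighbours of $v_i$ and $v_j$ if $i\ne j$, and $0$ if $i=j$; let $CNRS(\mathcal G)$ be the diagonal matrix of the row sums of $CN(\mathcal G)$, and put $\Delta=\operatorname{tr}(CNRS(\mathcal G))/N$. Let $E_{CN}(\mathcal G)=\sum|\lambda|$ over the eigenvalues $\lambda$ of $CN(\mathcal G)$, $LE_{CN}(\mathcal G)=\sum|\alpha-\Delta|$ over the eigenvalues $\alpha$ of $CNRS(\mathcal G)-CN(\mathcal G)$, and $LE^+_{CN}(\mathcal G)=\sum|\beta-\Delta|$ over the eigenvalues $\beta$ of $CNRS(\mathcal G)+CN(\mathcal G)$, all eigenvalues being counted with multiplicity. Let $G$ be one of the following groups: - $D_{2n}=\langle x,y: x^n=y^2=1,\ yxy^{-1}=x^{-1}\rangle$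 with $n\ge 3$; - $T_{4n}=\langle x,y: x^{2n}=1,\ x^n=y^2,\ y^{-1}xy=x^{-1}\rangle$ with $n\ge 2$; - $U_{6n}=\langle x,y: x^{2n}=y^3=1,\ x^{-1}yx=y^{-1}\rangle$ with $n\ge 2$; - $SD_{8n}=\langle x,y: x^{4n}=y^2=1,\ yxy=x^{2n-1}\rangle$ with $n\ge 2$; - $V_{8n}=\langle x,y: x^{2n}=y^4=1,\ yx=x^{-1}y^{-1},\ y^{-1}x=x^{-1}y\rangle$ with $n\ge 2$; - $U_{(n,m)}=\langle x,y: x^{2n}=y^m=1,\ x^{-1}yx=y^{-1}\rangle$ with $n\ge 2$ and $m\ge 3$. Then 1. $E_{CN}(\Gamma_G)=LE^+_{CN}(\Gamma_G)=LE_{CN}(\Gamma_G)$ if and only if $G$ is one of $D_6$, $D_8$, $D_{10}$, $D_{12}$, $T_8$, $T_{12}$, $SD_{24}$, $V_{16}$, $U_{6n}$ with $n\ge 2$, or $U_{(n,m)}$ with $m\in\{3,4,6\}$ and $n\ge 2$; 2. $E_{CN}(\Gamma_G)<LE^+_{CN}(\Gamma_G)<LE_{CN}(\Gamma_G)$ if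 and only if $G$ is not one of the groups listed in (1). -/

import Mathlib

/-! ### Common neighborhood matrices and energies of a finite graph -/

namespace SimpleGraph

variable {V : Type*} [Fintype V]

open scoped Classical in
/-- The common neighborhood matrix: for `i ≠ j` the entry is the number of common neighbors of
`i` and `j`, and the diagonal is zero. -/
noncomputable def cnMatrix (Γ : SimpleGraph V) : Matrix V V ℝ :=
  Matrix.of fun i j => if i = j then 0 else ((Γ.commonNeighbors i j).ncard : ℝ)

open scoped Classical in
/-- The diagonal matrix of the row sums of the common neighborhood matrix. -/
noncomputable def cnrsMatrix (Γ : SimpleGraph V) : Matrix V V ℝ :=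
  Matrix.diagonal fun i => ∑ k, Γ.cnMatrix i k

/-- The common neighborhood Laplacian matrix. -/
noncomputable def cnlMatrix (Γ : SimpleGraph V) : Matrix V V ℝ :=
  Γ.cnrsMatrix - Γ.cnMatrix

/-- The common neighborhood signless Laplacian matrix. -/
noncomputable def cnslMatrix (Γ : SimpleGraph V) : Matrix V V ℝ :=
  Γ.cnrsMatrix + Γ.cnMatrix

open scoped Classical in
/-- The sum of `|t - c|` over the eigenvalues `t` of `M`, counted with multiplicity. It is only
used for real symmetric matrices, all of whose eigenvalues are real; they are the roots of the
characteristic polynomial, with multiplicity. -/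
noncomputable def eigenvalueDeviation (M : Matrix V V ℝ) (c : ℝ) : ℝ :=
  (M.charpoly.roots.map fun t => |t - c|).sum

/-- The mean `tr (CNRS) / |V|`. -/
noncomputable def cnMean (Γ : SimpleGraph V) : ℝ :=
  Γ.cnrsMatrix.trace / (Fintype.card V : ℝ)

/-- The CN-energy `E_CN`: the sum of the absolute values of the eigenvalues of the common
neighborhood matrix. -/
noncomputable def cnEnergy (Γ : SimpleGraph V) : ℝ :=
  eigenvalueDeviation Γ.cnMatrix 0

/-- The CNL-energy `LE_CN`. -/
noncomputable def cnlEnergy (Γ : SimpleGraph V) : ℝ :=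
  eigenvalueDeviation Γ.cnlMatrix Γ.cnMean

/-- The CNSL-energy `LE⁺_CN`. -/
noncomputable def cnslEnergy (Γ : SimpleGraph V) : ℝ :=
  eigenvalueDeviation Γ.cnslMatrix Γ.cnMean

end SimpleGraph

/-! ### The commuting conjugacy class graph -/

/-- The conjugacy classes of non-central elements of `G`, that is, the conjugacy classes with more
than one element. -/
def CCCVertex (G : Type*) [Group G] : Type _ := ↥(ConjClasses.noncenter G)

noncomputable instance (G : Type*) [Group G] [Finite G] : Fintype (CCCVertex G) :=
  haveI : Finite (ConjClasses G) := inferInstanceAs (Finite (Quotient _))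
  haveI : Finite (CCCVertex G) := inferInstanceAs (Finite ↥(ConjClasses.noncenter G))
  Fintype.ofFinite _

/-- The commuting conjugacy class graph: two distinct classes are adjacent when some element of the
one commutes with some element of the other. -/
def cccGraph (G : Type*) [Group G] : SimpleGraph (CCCVertex G) where
  Adj c d := c ≠ d ∧ ∃ g ∈ c.1.carrier, ∃ h ∈ d.1.carrier, g * h = h * g
  symm := ⟨fun _ _ ⟨hne, g, hg, h, hh, e⟩ => ⟨hne.symm, h, hh, g, hg, e.symm⟩⟩
  loopless := ⟨fun _ hc => hc.1 rfl⟩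

/-- `E_CN(Γ_G) = LE⁺_CN(Γ_G) = LE_CN(Γ_G)`. -/
def CNEnergiesEqual (G : Type*) [Group G] [Finite G] : Prop :=
  (cccGraph G).cnEnergy = (cccGraph G).cnslEnergy ∧
    (cccGraph G).cnslEnergy = (cccGraph G).cnlEnergy

/-- `E_CN(Γ_G) < LE⁺_CN(Γ_G) < LE_CN(Γ_G)`. -/
def CNEnergiesIncreasing (G : Type*) [Group G] [Finite G] : Prop :=
  (cccGraph G).cnEnergy < (cccGraph G).cnslEnergy ∧
    (cccGraph G).cnslEnergy < (cccGraph G).cnlEnergy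

/-! ### The families of groups

`D_{2n}` is Mathlib's `DihedralGroup n` (of order `2n`), and the dicyclic group `T_{4n}` is Mathlib's
`QuaternionGroup n` (of order `4n`). The other families are given by their presentations on two
generators `x` and `y`; a relation `u = v` is entered as `u * v⁻¹`. -/

namespace GroupFamilies

/-- The generator `x` of the free group. -/
def x : FreeGroup (Fin 2) := FreeGroup.of 0

/-- The generator `y` of the free group. -/
def y : FreeGroup (Fin 2) := FreeGroup.of 1

/-- `x^(2n) = y^m = 1`, `x⁻¹ y x = y⁻¹`. -/
def relsU (n m : ℕ) : Set (FreeGroup (Fin 2)) :=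
  {x ^ (2 * n), y ^ m, x⁻¹ * y * x * (y⁻¹)⁻¹}

/-- `x^(4n) = y^2 = 1`, `y x y = x^(2n-1)`. -/
def relsSD (n : ℕ) : Set (FreeGroup (Fin 2)) :=
  {x ^ (4 * n), y ^ 2, y * x * y * (x ^ (2 * n - 1))⁻¹}

/-- `x^(2n) = y^4 = 1`, `y x = x⁻¹ y⁻¹`, `y⁻¹ x = x⁻¹ y`. -/
def relsV (n : ℕ) : Set (FreeGroup (Fin 2)) :=
  {x ^ (2 * n), y ^ 4, y * x * (x⁻¹ * y⁻¹)⁻¹, y⁻¹ * x * (x⁻¹ * y)⁻¹}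

/-- The group `U_(n,m)`. -/
abbrev U (n m : ℕ) : Type := PresentedGroup (relsU n m)

/-- The group `U_{6n} = ⟨x, y : x^(2n) = y^3 = 1, x⁻¹ y x = y⁻¹⟩`, which is `U_(n,3)`. -/
abbrev U6 (n : ℕ) : Type := U n 3

/-- The semidihedral group `SD_{8n}`, indexed by `n`. -/
abbrev SD (n : ℕ) : Type := PresentedGroup (relsSD n)

/-- The group `V_{8n}`, indexed by `n`. -/
abbrev V (n : ℕ) : Type := PresentedGroup (relsV n)

/-! These groups are finite, so that their graphs are. -/

theorem finite_of_two_generators {G : Type*} [Group G] (a b : G)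
    (hgen : Subgroup.closure {a, b} = ⊤) (ha : IsOfFinOrder a) (hb : IsOfFinOrder b)
    (h : ∀ j : ℤ, ∃ i k : ℤ, b ^ j * a = a ^ i * b ^ k) : Finite G := by
  let S : Set G := Set.image2 (· * ·) (Subgroup.zpowers a : Set G) (Subgroup.zpowers b : Set G)
  have hSfin : S.Finite :=
    Set.Finite.image2 _ (finite_zpowers.2 ha) (finite_zpowers.2 hb)
  have hSa : ∀ s ∈ S, s * a ∈ S := by
    rintro _ ⟨_, ⟨i, rfl⟩, _, ⟨j, rfl⟩, rfl⟩
    obtain ⟨i', k, e⟩ := h j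
    refine ⟨a ^ (i + i'), ⟨_, rfl⟩, b ^ k, ⟨_, rfl⟩, ?_⟩
    simp only [mul_assoc, e, zpow_add]
  have hSb : ∀ s ∈ S, s * b ∈ S := by
    rintro _ ⟨_, ⟨i, rfl⟩, _, ⟨j, rfl⟩, rfl⟩
    refine ⟨a ^ i, ⟨_, rfl⟩, b ^ (j + 1), ⟨_, rfl⟩, ?_⟩
    simp only [mul_assoc, zpow_add_one]
  have hpow : ∀ c : G, (∀ s ∈ S, s * c ∈ S) → ∀ (k : ℕ), ∀ s ∈ S, s * c ^ k ∈ S := by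
    intro c hc k
    induction k with
    | zero => intro s hs; simpa using hs
    | succ k ih => intro s hs; rw [pow_succ, ← mul_assoc]; exact hc _ (ih s hs)
  have hinv : ∀ c : G, IsOfFinOrder c → (∀ s ∈ S, s * c ∈ S) → ∀ s ∈ S, s * c⁻¹ ∈ S := by
    intro c hc hSc s hs
    obtain ⟨k, hk, e⟩ := isOfFinOrder_iff_pow_eq_one.1 hc
    have : c⁻¹ = c ^ (k - 1) := by
      rw [inv_eq_iff_mul_eq_one, ← pow_succ', Nat.sub_add_cancel hk, e]
    rw [this]
    exact hpow c hSc _ s hs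
  have hall : ∀ g : G, g ∈ S := by
    intro g
    have hg : g ∈ Subgroup.closure {a, b} := hgen ▸ Subgroup.mem_top g
    induction hg using Subgroup.closure_induction_right with
    | one => exact ⟨1, one_mem _, 1, one_mem _, by simp⟩
    | mul_right s hs c hc ih =>
      rcases hc with rfl | rfl
      · exact hSa _ ih
      · exact hSb _ ih
    | mul_inv_cancel s hs c hc ih =>
      rcases hc with rfl | rfl
      · exact hinv _ ha hSa _ ih
      · exact hinv _ hb hSb _ ih
  exact Set.finite_univ_iff.1 (hSfin.subset fun g _ => hall g)

theorem closure_of (rels : Set (FreeGroup (Fin 2))) :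
    Subgroup.closure {PresentedGroup.mk rels x, PresentedGroup.mk rels y} = ⊤ := by
  rw [← PresentedGroup.closure_range_of rels]
  congr 1
  ext g
  simp only [Set.mem_insert_iff, Set.mem_singleton_iff, Set.mem_range, Fin.exists_fin_two]
  constructor <;> rintro (h | h) <;> [left; right; left; right] <;> exact h.symm

instance (n m : ℕ) [NeZero n] [NeZero m] : Finite (U n m) := by
  have hx := PresentedGroup.one_of_mem (rels := relsU n m) (x := x ^ (2 * n)) (by simp [relsU])
  have hy := PresentedGroup.one_of_mem (rels := relsU n m) (x := y ^ m) (by simp [relsU])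
  have hr := PresentedGroup.mk_eq_mk_of_mul_inv_mem (rels := relsU n m)
    (x := x⁻¹ * y * x) (y := y⁻¹) (by simp [relsU])
  simp only [map_pow, map_mul, map_inv] at hx hy hr
  refine finite_of_two_generators _ _ (closure_of _)
    (isOfFinOrder_iff_pow_eq_one.2 ⟨_, by have := NeZero.pos n; omega, hx⟩)
    (isOfFinOrder_iff_pow_eq_one.2 ⟨_, NeZero.pos m, hy⟩) fun j => ⟨1, -j, ?_⟩
  have hs : SemiconjBy (PresentedGroup.mk (relsU n m) x) (PresentedGroup.mk (relsU n m) y)⁻¹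
      (PresentedGroup.mk (relsU n m) y) := by
    rw [SemiconjBy, ← hr]; group
  have := (hs.zpow_right j).eq
  rw [← this]; simp

instance (n : ℕ) [NeZero n] : Finite (SD n) := by
  have hx := PresentedGroup.one_of_mem (rels := relsSD n) (x := x ^ (4 * n)) (by simp [relsSD])
  have hy := PresentedGroup.one_of_mem (rels := relsSD n) (x := y ^ 2) (by simp [relsSD])
  have hr := PresentedGroup.mk_eq_mk_of_mul_inv_mem (rels := relsSD n)
    (x := y * x * y) (y := x ^ (2 * n - 1)) (by simp [relsSD])
  simp only [map_pow, map_mul] at hx hy hr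
  refine finite_of_two_generators _ _ ((Set.pair_comm _ _) ▸ closure_of _)
    (isOfFinOrder_iff_pow_eq_one.2 ⟨_, two_pos, hy⟩)
    (isOfFinOrder_iff_pow_eq_one.2 ⟨_, by have := NeZero.pos n; omega, hx⟩)
    fun j => ⟨1, ((2 * n - 1 : ℕ) : ℤ) * j, ?_⟩
  have hs : SemiconjBy (PresentedGroup.mk (relsSD n) y)
      (PresentedGroup.mk (relsSD n) x ^ (2 * n - 1)) (PresentedGroup.mk (relsSD n) x) := by
    rw [SemiconjBy, ← hr, ← mul_assoc, ← mul_assoc, ← pow_two, hy, one_mul]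
  have := (hs.zpow_right j).eq
  rw [← this, zpow_mul]; simp

instance (n : ℕ) [NeZero n] : Finite (V n) := by
  have hx := PresentedGroup.one_of_mem (rels := relsV n) (x := x ^ (2 * n)) (by simp [relsV])
  have hy := PresentedGroup.one_of_mem (rels := relsV n) (x := y ^ 4) (by simp [relsV])
  have hr := PresentedGroup.mk_eq_mk_of_mul_inv_mem (rels := relsV n)
    (x := y * x) (y := x⁻¹ * y⁻¹) (by simp [relsV])
  have ht := PresentedGroup.mk_eq_mk_of_mul_inv_mem (rels := relsV n)
    (x := y⁻¹ * x) (y := x⁻¹ * y) (by simp [relsV])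
  simp only [map_pow, map_mul, map_inv] at hx hy hr ht
  refine finite_of_two_generators _ _ (closure_of _)
    (isOfFinOrder_iff_pow_eq_one.2 ⟨_, by have := NeZero.pos n; omega, hx⟩)
    (isOfFinOrder_iff_pow_eq_one.2 ⟨_, by norm_num, hy⟩) fun j => ?_
  generalize PresentedGroup.mk (relsV n) x = a at *
  generalize PresentedGroup.mk (relsV n) y = b at *
  have hinv : b * a⁻¹ = a * b⁻¹ := by
    have := congrArg (·⁻¹) ht
    simp only [mul_inv_rev, inv_inv] at this
    calc b * a⁻¹ = b * (a⁻¹ * b) * b⁻¹ := by group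
      _ = a * b⁻¹ := by rw [← ht]; group
  have hb4 : b ^ (4 : ℤ) = 1 := by exact_mod_cast hy
  have hsq : SemiconjBy a (b ^ (2 : ℤ)) (b ^ (2 : ℤ)) := by
    have h1 : b ^ (2 : ℤ) * a = a * b ^ (-2 : ℤ) := by
      calc b ^ (2 : ℤ) * a = b * (b * a) := by rw [zpow_two, mul_assoc]
        _ = b * a⁻¹ * b⁻¹ := by rw [hr, mul_assoc]
        _ = a * b ^ (-2 : ℤ) := by rw [hinv]; group
    have h2 : b ^ (-2 : ℤ) = b ^ (2 : ℤ) := by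
      rw [show (-2 : ℤ) = 2 - 4 by norm_num, zpow_sub, hb4]; simp
    rw [SemiconjBy, h1, h2]
  obtain ⟨k, rfl | rfl⟩ := Int.even_or_odd' j
  · refine ⟨1, 2 * k, ?_⟩
    have := (hsq.zpow_right k).eq
    rw [← zpow_mul] at this
    rw [← this, zpow_one]
  · refine ⟨-1, 2 * k - 1, ?_⟩
    have := (hsq.inv_symm_left.zpow_right k).eq
    rw [← zpow_mul] at this
    rw [zpow_add, zpow_one, mul_assoc, hr, ← mul_assoc, ← this, zpow_sub, zpow_neg,
      zpow_one, zpow_one, mul_assoc]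

end GroupFamilies

/-! ### Spectra of block matrices -/

namespace Matrix

open Polynomial

/-! Every group `G` in the list has an abelian subgroup `A` of index two. Let `t` lie outside `A`
and act on it as `σ`, and put `δ = σ - 1`, so that `ker δ` is the centre and `range δ` the
commutator subgroup. The non-central classes inside `A` are the pairs `{a, σ a}`; they form one
clique, because `A` is abelian. The classes outside `A` correspond to the cosets of `range δ`, and
`a t`, `b t` commute exactly when `a - b ∈ ker δ`. So two such classes are equal or adjacent iff
they agree modulo `H = ker δ + range δ`. No edge joins the two kinds, since a non-central element of
`A` commutes with nothing outside `A`. Hence the graph is a clique `K_p` together with `r` cliques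
`K_q`, where `r = [A : H]`, `r q = |ker δ|` and `2 p = |A| - |ker δ|` (`AbelianIndexTwo.adj_iff`,
`AbelianIndexTwo.isCliqueUnion`).

On a clique `K_s` the three matrices are combinations of the identity and the all-ones matrix. With
`f(s) = (s - 1)(s - 2)`, the eigenvalues are `f(s)` and `-(s - 2)` for CN, `0` and `s(s - 2)` for
CNL, `2 f(s)` and `(s - 2)²` for CNSL, the second of each pair with multiplicity `s - 1`; `Δ` is the
mean of `f` over the vertices. If all cliques have at most two vertices everything vanishes, and if
`p = q` the three energies agree by direct computation. If `p ≥ 3` and `p ≥ (r + 1) q`, both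
inequalities are strict (`IsCliqueUnion.energies_lt`).

It remains to compute `p, r, q` for each family. They always fall under one of these three cases,
and the equality cases are exactly the listed groups. The presented groups are first identified with
explicit extensions of `A` by `t`, through normal forms of words. -/

theorem charpoly_eq_of_entries {n : Type*} [Fintype n] [DecidableEq n] [Nonempty n]
    (M : Matrix n n ℝ) (a b : ℝ) (hM : ∀ i j, M i j = b + if i = j then a else 0) :
    M.charpoly = (X - C (a + Fintype.card n * b)) * (X - C a) ^ (Fintype.card n - 1) := by
  -- `M - a` has rank at most one, so its characteristic polynomial is known; translating the
  -- variable by `a` recovers that of `M`.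
  have h1 : M - scalar n a = vecMulVec (fun _ => b) (fun _ => 1) := by
    ext i j
    by_cases h : i = j <;> simp [vecMulVec, hM, h]
  have h2 := charpoly_sub_scalar M a
  rw [h1, charpoly_vecMulVec] at h2
  have h3 : M.charpoly = (M.charpoly.comp (X + C a)).comp (X - C a) := by
    rw [comp_assoc]; simp
  rw [h3, ← h2]
  obtain ⟨k, hk⟩ : ∃ k, Fintype.card n = k + 1 :=
    ⟨Fintype.card n - 1, (Nat.sub_add_cancel Fintype.card_pos).symm⟩
  simp [dotProduct, hk, pow_succ, smul_eq_C_mul]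
  ring

theorem roots_charpoly_of_entries {n : Type*} [Fintype n] [DecidableEq n] [Nonempty n]
    (M : Matrix n n ℝ) (a b : ℝ) (hM : ∀ i j, M i j = b + if i = j then a else 0) :
    M.charpoly.roots =
      (a + Fintype.card n * b) ::ₘ Multiset.replicate (Fintype.card n - 1) a := by
  rw [charpoly_eq_of_entries M a b hM, roots_mul, roots_X_sub_C, roots_pow, roots_X_sub_C,
    Multiset.nsmul_singleton, Multiset.singleton_add]
  exact mul_ne_zero (X_sub_C_ne_zero _) (pow_ne_zero _ (X_sub_C_ne_zero _))

end Matrix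

namespace SimpleGraph

open scoped Classical in
/-- The eigenvalue deviation of a matrix that is constant off the diagonal and on the diagonal of
each of the square blocks given by the fibers of `f`, and zero elsewhere. -/
theorem eigenvalueDeviation_of_fibers {V ι : Type*} [Fintype V] [Fintype ι] (f : V → ι)
    (hf : Function.Surjective f) (M : Matrix V V ℝ) (a b : ι → ℝ)
    (hM : ∀ v w, M v w = if f v = f w then b (f v) + (if v = w then a (f v) else 0) else 0)
    (c : ℝ) :
    eigenvalueDeviation M c = ∑ i, (|a i + Nat.card {v // f v = i} * b i - c| +
      ((Nat.card {v // f v = i} : ℝ) - 1) * |a i - c|) := by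
  -- The matrix is block diagonal, so any order on the index set makes it block triangular; this one
  -- is arbitrary.
  let _ : LinearOrder ι := LinearOrder.lift' (Fintype.equivFin ι) (Fintype.equivFin ι).injective
  have ht : M.BlockTriangular f := by
    intro v w h
    rw [hM, if_neg h.ne']
  unfold eigenvalueDeviation
  have himg : Finset.image f Finset.univ = Finset.univ := Finset.image_univ_of_surjective hf
  have hcp := ht.charpoly
  have hconv : ∀ (d : DecidableEq V), @Matrix.charpoly ℝ _ V d _ M = M.charpoly := by
    intro d; congr
  rw [hconv] at hcp
  rw [hcp, Polynomial.roots_prod _ _ (Finset.prod_ne_zero_iff.2 fun i _ =>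
    (Matrix.charpoly_monic _).ne_zero), Multiset.map_bind, Multiset.sum_bind]
  have himg' : ∀ (d : DecidableEq ι), @Finset.image _ _ d f Finset.univ = Finset.univ := by
    intro d; convert himg
  rw [himg']
  refine Finset.sum_congr rfl fun i _ => ?_
  obtain ⟨v, hv⟩ := hf i
  have : Nonempty {v // f v = i} := ⟨⟨v, hv⟩⟩
  have hr := Matrix.roots_charpoly_of_entries (M.toSquareBlock f i) (a i) (b i) (by
    rintro ⟨v, hv⟩ ⟨w, hw⟩
    simp [Matrix.toSquareBlock_def, hM, hv, hw])
  have : 1 ≤ Fintype.card {v // f v = i} := Fintype.card_pos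
  have hconv2 : ∀ (d : DecidableEq {v // f v = i}) (d' : Fintype {v // f v = i}), 
      (@Matrix.charpoly ℝ _ _ d d' (M.toSquareBlock f i)) = (M.toSquareBlock f i).charpoly := by
    intro d d'; congr!
  rw [hconv2, hr]
  simp [Nat.card_eq_fintype_card, this, Nat.cast_sub]

end SimpleGraph

/-! ### Matrices and energies of disjoint unions of cliques -/

namespace SimpleGraph

section CliqueUnion

variable {V ι : Type*} [Fintype V] {Γ : SimpleGraph V} {f : V → ι}

open scoped Classical in
theorem cnMatrix_of_fibers (hΓ : ∀ v w, Γ.Adj v w ↔ v ≠ w ∧ f v = f w) (v w : V) :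
    Γ.cnMatrix v w = if f v = f w then ((Nat.card {u // f u = f v} : ℝ) - 2) +
      (if v = w then -((Nat.card {u // f u = f v} : ℝ) - 2) else 0) else 0 := by
  unfold cnMatrix
  rw [Matrix.of_apply]
  by_cases h : v = w
  · subst h; simp
  rw [if_neg h]
  by_cases hf : f v = f w
  -- In a clique the common neighbours of `v` and `w` are all the other vertices, which gives the
  -- entry `s - 2`.
  · have hset : insert v (insert w (Γ.commonNeighbors v w)) = {u | f u = f v} := by
      ext u
      simp only [Set.mem_insert_iff, mem_commonNeighbors, hΓ, Set.mem_ofPred_eq]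
      constructor
      · rintro (rfl | rfl | h)
        · rfl
        · exact hf.symm
        · exact h.1.2.symm
      · intro hu
        by_cases h1 : u = v
        · exact .inl h1
        by_cases h2 : u = w
        · exact .inr (.inl h2)
        exact .inr (.inr ⟨⟨Ne.symm h1, hu.symm⟩, Ne.symm h2, (hu.trans hf).symm⟩)
    have hv : v ∉ insert w (Γ.commonNeighbors v w) := by
      simp [mem_commonNeighbors, h]
    have hw : w ∉ Γ.commonNeighbors v w := by simp [mem_commonNeighbors]
    have hcard : Nat.card {u // f u = f v} = (Γ.commonNeighbors v w).ncard + 2 := by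
      change Nat.card ({u | f u = f v} : Set V) = _
      rw [Nat.card_coe_set_eq, ← hset, Set.ncard_insert_of_notMem hv (Set.toFinite _),
        Set.ncard_insert_of_notMem hw (Set.toFinite _)]
    rw [if_neg h, if_pos hf, hcard]
    push_cast
    ring
  · have hset : Γ.commonNeighbors v w = ∅ := by
      ext u
      simp only [mem_commonNeighbors, hΓ, Set.mem_empty_iff_false, iff_false]
      exact fun h => hf (h.1.2.trans h.2.2.symm)
    simp [hset, hf]

theorem cnMatrix_row_sum_of_fibers (hΓ : ∀ v w, Γ.Adj v w ↔ v ≠ w ∧ f v = f w) (v : V) :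
    ∑ w, Γ.cnMatrix v w =
      ((Nat.card {u // f u = f v} : ℝ) - 1) * ((Nat.card {u // f u = f v} : ℝ) - 2) := by
  classical
  have h1 : ∀ w, Γ.cnMatrix v w = (if f w = f v then ((Nat.card {u // f u = f v} : ℝ) - 2) else 0) +
      (if v = w then -((Nat.card {u // f u = f v} : ℝ) - 2) else 0) := by
    intro w
    rw [cnMatrix_of_fibers hΓ]
    by_cases h : v = w
    · subst h; simp
    · simp [h, eq_comm]
  simp_rw [h1]
  rw [Finset.sum_add_distrib, Finset.sum_ite_eq, ← Finset.sum_filter, Finset.sum_const,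
    Nat.card_eq_fintype_card, Fintype.card_subtype, nsmul_eq_mul]
  simp
  ring

variable [Fintype ι]

theorem cnMean_of_fibers (hΓ : ∀ v w, Γ.Adj v w ↔ v ≠ w ∧ f v = f w) :
    Γ.cnMean = (∑ i, (Nat.card {v // f v = i} : ℝ) * (((Nat.card {v // f v = i} : ℝ) - 1) *
      ((Nat.card {v // f v = i} : ℝ) - 2))) / ∑ i, (Nat.card {v // f v = i} : ℝ) := by
  classical
  have key : ∀ F : ι → ℝ, ∑ v, F (f v) = ∑ i, (Nat.card {v // f v = i} : ℝ) * F i := by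
    intro F
    rw [← Finset.sum_fiberwise Finset.univ f]
    refine Finset.sum_congr rfl fun i _ => ?_
    rw [Finset.sum_congr rfl (g := fun _ => F i) fun v hv => by rw [(Finset.mem_filter.1 hv).2],
      Finset.sum_const, nsmul_eq_mul, Nat.card_eq_fintype_card, Fintype.card_subtype]
  have h0 := key fun _ => 1
  simp only [Finset.sum_const, Finset.card_univ, nsmul_eq_mul, mul_one] at h0
  unfold cnMean cnrsMatrix
  rw [Matrix.trace_diagonal, h0]
  simp_rw [cnMatrix_row_sum_of_fibers hΓ]
  rw [key fun i => ((Nat.card {v // f v = i} : ℝ) - 1) * ((Nat.card {v // f v = i} : ℝ) - 2)]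

theorem cnEnergy_of_fibers (hf : Function.Surjective f)
    (hΓ : ∀ v w, Γ.Adj v w ↔ v ≠ w ∧ f v = f w) :
    Γ.cnEnergy = ∑ i, (|((Nat.card {v // f v = i} : ℝ) - 1) * ((Nat.card {v // f v = i} : ℝ) - 2)| +
      ((Nat.card {v // f v = i} : ℝ) - 1) * |(Nat.card {v // f v = i} : ℝ) - 2|) := by
  unfold cnEnergy
  rw [eigenvalueDeviation_of_fibers f hf _ (fun i => -((Nat.card {v // f v = i} : ℝ) - 2))
    (fun i => (Nat.card {v // f v = i} : ℝ) - 2) (cnMatrix_of_fibers hΓ)]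
  refine Finset.sum_congr rfl fun i _ => ?_
  rw [sub_zero, sub_zero, abs_neg]
  congr 2
  ring

theorem cnlEnergy_of_fibers (hf : Function.Surjective f)
    (hΓ : ∀ v w, Γ.Adj v w ↔ v ≠ w ∧ f v = f w) :
    Γ.cnlEnergy = ∑ i, (|Γ.cnMean| + ((Nat.card {v // f v = i} : ℝ) - 1) *
      |(Nat.card {v // f v = i} : ℝ) * ((Nat.card {v // f v = i} : ℝ) - 2) - Γ.cnMean|) := by
  classical
  unfold cnlEnergy
  rw [eigenvalueDeviation_of_fibers f hf _
    (fun i => (Nat.card {v // f v = i} : ℝ) * ((Nat.card {v // f v = i} : ℝ) - 2))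
    (fun i => -((Nat.card {v // f v = i} : ℝ) - 2))]
  · refine Finset.sum_congr rfl fun i _ => ?_
    rw [mul_neg, add_neg_cancel, zero_sub, abs_neg]
  · intro v w
    rw [cnlMatrix, Matrix.sub_apply, cnMatrix_of_fibers hΓ, cnrsMatrix, Matrix.diagonal_apply,
      cnMatrix_row_sum_of_fibers hΓ]
    by_cases h : v = w
    · subst h; simp; ring
    · by_cases h' : f v = f w <;> simp [h, h']

theorem cnslEnergy_of_fibers (hf : Function.Surjective f)
    (hΓ : ∀ v w, Γ.Adj v w ↔ v ≠ w ∧ f v = f w) :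
    Γ.cnslEnergy = ∑ i, (|2 * (((Nat.card {v // f v = i} : ℝ) - 1) *
        ((Nat.card {v // f v = i} : ℝ) - 2)) - Γ.cnMean| +
      ((Nat.card {v // f v = i} : ℝ) - 1) *
        |((Nat.card {v // f v = i} : ℝ) - 2) ^ 2 - Γ.cnMean|) := by
  classical
  unfold cnslEnergy
  rw [eigenvalueDeviation_of_fibers f hf _
    (fun i => ((Nat.card {v // f v = i} : ℝ) - 2) ^ 2)
    (fun i => (Nat.card {v // f v = i} : ℝ) - 2)]
  · refine Finset.sum_congr rfl fun i _ => ?_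
    congr 2
    ring
  · intro v w
    rw [cnslMatrix, Matrix.add_apply, cnMatrix_of_fibers hΓ, cnrsMatrix, Matrix.diagonal_apply,
      cnMatrix_row_sum_of_fibers hΓ]
    by_cases h : v = w
    · subst h; simp; ring
    · by_cases h' : f v = f w <;> simp [h, h']

end CliqueUnion

/-- The graph is the disjoint union of a complete graph on `p` vertices and `r` complete graphs on
`q` vertices each. -/
def IsCliqueUnion {V : Type*} (Γ : SimpleGraph V) (p r q : ℕ) : Prop :=
  ∃ f : V → Option (Fin r), (∀ v w, Γ.Adj v w ↔ v ≠ w ∧ f v = f w) ∧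
    Nat.card {v // f v = none} = p ∧ ∀ k, Nat.card {v // f v = some k} = q

/-! ### Comparison of the three energies -/

namespace IsCliqueUnion

variable {V : Type*} [Fintype V] {Γ : SimpleGraph V} {p r q : ℕ}

/-- `Δ` is described by its defining equation cleared of the denominator, so that later arguments
are polynomial. -/
theorem energies (h : Γ.IsCliqueUnion p r q) (hp : 1 ≤ p) (hq : 1 ≤ q) :
    ∃ Δ : ℝ, Δ * (p + r * q) = p * ((p - 1) * (p - 2)) + r * (q * ((q - 1) * (q - 2))) ∧
      Γ.cnEnergy = 2 * ((p - 1) * (p - 2)) + r * (2 * ((q - 1) * (q - 2))) ∧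
      Γ.cnlEnergy = (|Δ| + (p - 1) * |p * (p - 2) - Δ|) +
        r * (|Δ| + (q - 1) * |q * (q - 2) - Δ|) ∧
      Γ.cnslEnergy = (|2 * ((p - 1) * (p - 2)) - Δ| + (p - 1) * |((p : ℝ) - 2) ^ 2 - Δ|) +
        r * (|2 * ((q - 1) * (q - 2)) - Δ| + (q - 1) * |((q : ℝ) - 2) ^ 2 - Δ|) := by
  obtain ⟨f, hΓ, hn, hs⟩ := h
  have hf : Function.Surjective f := by
    have key : ∀ i, Nat.card {v // f v = i} ≠ 0 → ∃ v, f v = i := by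
      intro i hi
      obtain ⟨⟨v, hv⟩⟩ := (Nat.card_ne_zero.1 hi).1
      exact ⟨v, hv⟩
    rintro (_ | k)
    · exact key _ (by omega)
    · exact key _ (by rw [hs]; omega)
  -- For `s = 1` the factor `s - 2` is negative, but it only occurs multiplied by `s - 1 = 0`.
  have hmul : ∀ s : ℕ, 1 ≤ s → |((s : ℝ) - 1) * (s - 2)| + (s - 1) * |(s : ℝ) - 2| =
      2 * ((s - 1) * (s - 2)) := by
    intro s h1
    rcases h1.eq_or_lt with rfl | h2
    · norm_num
    · have h1' : (1 : ℝ) ≤ s := by exact_mod_cast h1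
      have h2' : (2 : ℝ) ≤ s := by exact_mod_cast h2
      rw [abs_of_nonneg (mul_nonneg (by linarith) (by linarith)), abs_of_nonneg (by linarith)]
      ring
  refine ⟨Γ.cnMean, ?_, ?_, ?_, ?_⟩
  · rw [cnMean_of_fibers hΓ]
    simp only [Fintype.sum_option, hn, hs, Finset.sum_const, Finset.card_univ, Fintype.card_fin,
      nsmul_eq_mul]
    refine div_mul_cancel₀ _ ?_
    positivity
  · rw [cnEnergy_of_fibers hf hΓ]
    simp only [Fintype.sum_option, hn, hs, Finset.sum_const, Finset.card_univ, Fintype.card_fin,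
      nsmul_eq_mul, hmul p hp, hmul q hq]
  · rw [cnlEnergy_of_fibers hf hΓ]
    simp only [Fintype.sum_option, hn, hs, Finset.sum_const, Finset.card_univ, Fintype.card_fin,
      nsmul_eq_mul]
  · rw [cnslEnergy_of_fibers hf hΓ]
    simp only [Fintype.sum_option, hn, hs, Finset.sum_const, Finset.card_univ, Fintype.card_fin,
      nsmul_eq_mul]

/-- Cliques with at most two vertices have no common neighbours, so `f` vanishes on every component
and all three energies are zero. -/
theorem energies_eq_of_small (h : Γ.IsCliqueUnion p r q) (hp : p = 1 ∨ p = 2)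
    (hq : q = 1 ∨ q = 2) : Γ.cnEnergy = Γ.cnslEnergy ∧ Γ.cnslEnergy = Γ.cnlEnergy := by
  obtain ⟨Δ, hΔ, hE, hL, hS⟩ := h.energies (by omega) (by omega)
  have h0 : Δ = 0 := by
    have hpos : (0 : ℝ) < p + r * q := by
      have : (0 : ℝ) < p := by rcases hp with rfl | rfl <;> norm_num
      positivity
    have h0 : Δ * (p + r * q) = 0 := by
      rw [hΔ]; rcases hp with rfl | rfl <;> rcases hq with rfl | rfl <;> norm_num
    rcases mul_eq_zero.1 h0 with h | h
    · exact h
    · exact absurd h hpos.ne'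
  rw [hE, hL, hS, h0]
  rcases hp with rfl | rfl <;> rcases hq with rfl | rfl <;> norm_num

/-- With equal cliques `Δ = f(p)`, and every component contributes `2 f(p)` to each energy. -/
theorem energies_eq_of_eq (h : Γ.IsCliqueUnion p r p) (hp : 1 ≤ p) :
    Γ.cnEnergy = Γ.cnslEnergy ∧ Γ.cnslEnergy = Γ.cnlEnergy := by
  obtain ⟨Δ, hΔ, hE, hL, hS⟩ := h.energies hp hp
  have hp' : (1 : ℝ) ≤ p := by exact_mod_cast hp
  have hpos : (0 : ℝ) < p + r * p := by positivity
  have h0 : Δ = (p - 1) * (p - 2) := by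
    refine mul_right_cancel₀ hpos.ne' ?_
    rw [hΔ]; ring
  rcases hp.eq_or_lt with rfl | h2
  · rw [hE, hL, hS, h0]; norm_num
  have h2' : (2 : ℝ) ≤ p := by exact_mod_cast h2
  have e1 : (p : ℝ) * (p - 2) - Δ = p - 2 := by rw [h0]; ring
  have e2 : 2 * (((p : ℝ) - 1) * (p - 2)) - Δ = Δ := by rw [h0]; ring
  have e3 : ((p : ℝ) - 2) ^ 2 - Δ = -(p - 2) := by rw [h0]; ring
  have h0' : 0 ≤ Δ := h0 ▸ mul_nonneg (by linarith) (by linarith)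
  rw [hE, hL, hS, e1, e2, e3, abs_neg, abs_of_nonneg h0',
    abs_of_nonneg (by linarith : (0 : ℝ) ≤ p - 2), h0]
  constructor <;> ring

/-- The large clique dominates: `2 f(q) ≤ Δ` and `Δ + r f(q) < f(p)`. The first bound fixes the
signs inside the absolute values of the small cliques. The only undetermined sign is that of `(p -
2)² - Δ`. -/
theorem energies_lt (h : Γ.IsCliqueUnion p r q) (hr : 1 ≤ r) (hq : 1 ≤ q) (hp : 3 ≤ p)
    (hpq : (r + 1) * q ≤ p) : Γ.cnEnergy < Γ.cnslEnergy ∧ Γ.cnslEnergy < Γ.cnlEnergy := by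
  obtain ⟨Δ, hΔ, hE, hL, hS⟩ := h.energies (by omega) hq
  -- Integrality of `q` is recorded before passing to reals, since `f` is negative between `1` and
  -- `2`.
  have hq2 : (q - 1 : ℝ) = 0 ∨ (2 : ℝ) ≤ q := by
    rcases hq.eq_or_lt with rfl | h2
    · left; norm_num
    · right; exact_mod_cast h2
  rify at hr hq hp hpq
  rw [hE, hL, hS]
  generalize (p : ℝ) = p at *
  generalize (q : ℝ) = q at *
  generalize (r : ℝ) = r at *
  clear hE hL hS
  have hrq : q ≤ r * q := by nlinarith
  have hp2q : 2 * q ≤ p := by nlinarith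
  have hN : 0 < p + r * q := by nlinarith
  have hfp : 0 < (p - 1) * (p - 2) := mul_pos (by linarith) (by linarith)
  have hfq : 0 ≤ (q - 1) * (q - 2) := by
    rcases hq2 with h | h
    · rw [h, zero_mul]
    · exact mul_nonneg (by linarith) (by linarith)
  have hfpq : 3 * ((q - 1) * (q - 2)) ≤ (p - 1) * (p - 2) := by nlinarith
  have hpos : 0 < Δ := by
    refine pos_of_mul_pos_left ?_ hN.le
    rw [hΔ]
    exact add_pos_of_pos_of_nonneg (mul_pos (by linarith) hfp)
      (mul_nonneg (by linarith) (mul_nonneg (by linarith) hfq))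
  have hΔq : 2 * ((q - 1) * (q - 2)) ≤ Δ := by
    refine le_of_mul_le_mul_right ?_ hN
    rw [hΔ]
    have h1 : p * (3 * ((q - 1) * (q - 2))) ≤ p * ((p - 1) * (p - 2)) :=
      mul_le_mul_of_nonneg_left hfpq (by linarith)
    have h2 : (r * q) * ((q - 1) * (q - 2)) ≤ p * ((q - 1) * (q - 2)) :=
      mul_le_mul_of_nonneg_right (by linarith) hfq
    linarith
  -- Here `(p - q)(p + q - 3) = f(p) - f(q)`, and `2 p - q` bounds the number `p + r q` of vertices.
  -- Writing `p = 2 q + s`, `q = 1 + t` makes every coefficient of the difference nonnegative.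
  have hsep : (q - 1) * (q - 2) * (2 * p - q) < q * ((p - q) * (p + q - 3)) := by
    obtain ⟨s, rfl⟩ : ∃ s, p = 2 * q + s := ⟨p - 2 * q, by ring⟩
    obtain ⟨t, rfl⟩ : ∃ t, q = 1 + t := ⟨q - 1, by ring⟩
    have ht : 0 ≤ t := by linarith
    have hs : 0 ≤ s := by linarith
    have hst : 0 < 6 * t + s := by linarith
    have key : (1 + t) * ((2 * (1 + t) + s - (1 + t)) * (2 * (1 + t) + s + (1 + t) - 3)) -
        (1 + t - 1) * (1 + t - 2) * (2 * (2 * (1 + t) + s) - (1 + t)) =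
        6 * t + s + (6 * t ^ 2 + 7 * (t * s) + 2 * (t ^ 2 * s) + s ^ 2 + t * s ^ 2) := by ring
    have : 0 ≤ 6 * t ^ 2 + 7 * (t * s) + 2 * (t ^ 2 * s) + s ^ 2 + t * s ^ 2 := by positivity
    linarith
  have hΔp : r * ((q - 1) * (q - 2)) < (p - 1) * (p - 2) - Δ := by
    refine lt_of_mul_lt_mul_right ?_ hN.le
    have h1 : (q - 1) * (q - 2) * (p + r * q) ≤ (q - 1) * (q - 2) * (2 * p - q) :=
      mul_le_mul_of_nonneg_left (by linarith) hfq
    have h2 := mul_lt_mul_of_pos_left (h1.trans_lt hsep) (by linarith : 0 < r)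
    have h3 : ((p - 1) * (p - 2) - Δ) * (p + r * q) = r * (q * ((p - q) * (p + q - 3))) := by
      rw [sub_mul, hΔ]; ring
    rw [h3, mul_assoc]
    exact h2
  have hrf : 0 ≤ r * ((q - 1) * (q - 2)) := mul_nonneg (by linarith) hfq
  have e1 : (q - 1) * |q * (q - 2) - Δ| = (q - 1) * (Δ - q * (q - 2)) := by
    rcases hq2 with h | h
    · rw [h, zero_mul, zero_mul]
    · rw [abs_of_nonpos (by nlinarith)]; ring
  have e2 : (q - 1) * |(q - 2) ^ 2 - Δ| = (q - 1) * (Δ - (q - 2) ^ 2) := by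
    rcases hq2 with h | h
    · rw [h, zero_mul, zero_mul]
    · rw [abs_of_nonpos (by nlinarith)]; ring
  rw [e1, e2, abs_of_pos hpos, abs_of_nonneg (by nlinarith : 0 ≤ p * (p - 2) - Δ),
    abs_of_nonneg (by nlinarith : 0 ≤ 2 * ((p - 1) * (p - 2)) - Δ),
    abs_of_nonpos (by linarith : 2 * ((q - 1) * (q - 2)) - Δ ≤ 0)]
  constructor
  -- Bounding the absolute value by `Δ - (p - 2)²` and eliminating `Δ (p + r q)` gives a CNSL-energy
  -- of at least `4 f(p) - 2 Δ`. This exceeds `2 f(p) + 2 r f(q)` by `hΔp`.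
  · have h1 := mul_le_mul_of_nonneg_left (neg_le_abs ((p - 2) ^ 2 - Δ))
      (by linarith : 0 ≤ p - 1)
    linarith
  -- The difference of the two energies is `2 Δ` in the first case and `2 (p - 2)(f(p) - Δ)` in the
  -- second.
  · rcases abs_cases ((p - 2) ^ 2 - Δ) with ⟨h, -⟩ | ⟨h, -⟩
    · rw [h]
      linarith
    · rw [h]
      have : (p - 2) * Δ < (p - 2) * ((p - 1) * (p - 2)) :=
        mul_lt_mul_of_pos_left (by linarith) (by linarith)
      linarith

end IsCliqueUnion

end SimpleGraph

/-! ### Conjugacy and commuting in groups with an abelian subgroup of index two -/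

theorem Nat.card_eq_mul_card_of_fibers {X Y : Type*} [Finite X] [Finite Y] (g : X → Y) (k : ℕ)
    (h : ∀ y, Nat.card {x // g x = y} = k) : Nat.card X = k * Nat.card Y := by
  have := Fintype.ofFinite Y
  rw [Nat.card_congr (Equiv.sigmaFiberEquiv g).symm, Nat.card_sigma]
  simp [h, mul_comm]

theorem ConjClasses.mk_mem_noncenter_iff {G : Type*} [Group G] {g : G} :
    ConjClasses.mk g ∈ ConjClasses.noncenter G ↔ ∃ h, IsConj g h ∧ h ≠ g := by
  rw [ConjClasses.mem_noncenter]
  have hg : g ∈ (ConjClasses.mk g).carrier := ConjClasses.mem_carrier_mk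
  constructor
  · intro h
    obtain ⟨k, hk, hne⟩ := h.exists_ne g
    exact ⟨k, (ConjClasses.mk_eq_mk_iff_isConj.1 (ConjClasses.mem_carrier_iff_mk_eq.1 hk)).symm,
      hne⟩
  · rintro ⟨k, hk, hne⟩
    exact ⟨k, ConjClasses.mem_carrier_iff_mk_eq.2 (ConjClasses.mk_eq_mk_iff_isConj.2 hk.symm),
      g, hg, hne⟩

namespace CCCVertex

variable {G : Type*} [Group G]

/-- The class of a non-central element as a vertex. -/
def mk (g : G) (hg : ConjClasses.mk g ∈ ConjClasses.noncenter G) : CCCVertex G :=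
  Subtype.mk (ConjClasses.mk g) hg

theorem exists_mk (v : CCCVertex G) : ∃ g hg, mk g hg = v := by
  obtain ⟨c, hc⟩ := v
  obtain ⟨g, rfl⟩ := ConjClasses.exists_rep c
  exact ⟨g, hc, rfl⟩

theorem mk_eq_mk_iff {g h : G} {hg : ConjClasses.mk g ∈ ConjClasses.noncenter G}
    {hh : ConjClasses.mk h ∈ ConjClasses.noncenter G} : mk g hg = mk h hh ↔ IsConj g h :=
  Subtype.ext_iff.trans ConjClasses.mk_eq_mk_iff_isConj

end CCCVertex

/-- An abelian subgroup of index two of `G`, given by an injective homomorphism `φ` from an additive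
group, together with an element `t` outside it, which acts on the subgroup as `σ`. -/
structure AbelianIndexTwo (A G : Type*) [AddCommGroup A] [Group G] where
  φ : A → G
  t : G
  σ : A →+ A
  map_add : ∀ a b, φ (a + b) = φ a * φ b
  injective : Function.Injective φ
  conj : ∀ a, t * φ a = φ (σ a) * t
  cover : ∀ g, (∃ a, φ a = g) ∨ ∃ a, φ a * t = g
  ne : ∀ a, φ a ≠ t

namespace AbelianIndexTwo

variable {A G : Type*} [AddCommGroup A] [Group G] (E : AbelianIndexTwo A G)

/-- The homomorphism `a ↦ σ a - a`; its kernel is the centre of `G` when `G` is not abelian, and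
its range is the commutator subgroup of `G`. -/
def δ : A →+ A := E.σ - AddMonoidHom.id A

theorem δ_apply (a : A) : E.δ a = E.σ a - a := rfl

theorem map_zero : E.φ 0 = 1 := by
  have := E.map_add 0 0
  rwa [add_zero, left_eq_mul] at this

theorem map_neg (a : A) : E.φ (-a) = (E.φ a)⁻¹ := by
  rw [eq_inv_iff_mul_eq_one, ← E.map_add, neg_add_cancel, E.map_zero]

theorem ne_mul (a b : A) : E.φ a ≠ E.φ b * E.t := by
  intro h
  apply E.ne (-b + a)
  rw [E.map_add, h, E.map_neg, inv_mul_cancel_left]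

theorem mul_t_injective {a b : A} (h : E.φ a * E.t = E.φ b * E.t) : a = b :=
  E.injective (mul_right_cancel h)

theorem t_sq : ∃ c, E.φ c = E.t * E.t := by
  rcases E.cover (E.t * E.t) with h | ⟨a, h⟩
  · exact h
  · exact absurd (mul_right_cancel h) (E.ne a)

/-- The element `t²` lies in the abelian subgroup, so conjugation by it is trivial there. -/
theorem σ_σ (a : A) : E.σ (E.σ a) = a := by
  obtain ⟨c, hc⟩ := E.t_sq
  apply E.injective
  apply mul_right_cancel (b := E.φ c)
  rw [← E.map_add, add_comm, ← E.map_add, add_comm a c, E.map_add, E.map_add, hc]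
  calc E.t * E.t * E.φ (E.σ (E.σ a)) = E.φ c * E.φ (E.σ (E.σ a)) := by rw [hc]
    _ = E.φ (E.σ (E.σ a)) * E.φ c := by rw [← E.map_add, add_comm, E.map_add]
    _ = E.t * (E.t * E.φ a) := by rw [E.conj, ← mul_assoc, E.conj, mul_assoc, hc]
    _ = E.t * E.t * E.φ a := by rw [mul_assoc]

theorem isConj_φ_iff (a b : A) : IsConj (E.φ a) (E.φ b) ↔ b = a ∨ b = E.σ a := by
  rw [isConj_iff]
  constructor
  · rintro ⟨g, hg⟩
    rw [mul_inv_eq_iff_eq_mul] at hg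
    rcases E.cover g with ⟨c, rfl⟩ | ⟨c, rfl⟩
    · rw [← E.map_add, ← E.map_add] at hg
      left
      have := E.injective hg
      rw [add_comm] at this
      exact (add_right_cancel this).symm
    · rw [mul_assoc, E.conj, ← mul_assoc, ← mul_assoc, ← E.map_add, ← E.map_add] at hg
      right
      have := E.mul_t_injective hg
      rw [add_comm] at this
      exact (add_right_cancel this).symm
  · rintro (rfl | rfl)
    · exact ⟨1, by simp⟩
    · exact ⟨E.t, by rw [E.conj, mul_inv_cancel_right]⟩

/-- Conjugating `a t` by `c` gives `(a - δ c) t`, and conjugating it by `c t` gives `(a + δ (a - c))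
t`. -/
theorem isConj_mul_t_iff (a b : A) :
    IsConj (E.φ a * E.t) (E.φ b * E.t) ↔ b - a ∈ E.δ.range := by
  rw [isConj_iff]
  constructor
  · rintro ⟨g, hg⟩
    rw [mul_inv_eq_iff_eq_mul] at hg
    rcases E.cover g with ⟨c, rfl⟩ | ⟨c, rfl⟩
    · rw [mul_assoc, E.conj, ← mul_assoc, ← mul_assoc, ← E.map_add, ← E.map_add] at hg
      refine ⟨-c, ?_⟩
      have := E.mul_t_injective hg
      rw [_root_.map_neg, E.δ_apply, neg_sub, sub_eq_sub_iff_add_eq_add, this]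
    · have h1 : E.φ c * E.t * (E.φ a * E.t) = E.φ (c + E.σ a) * (E.t * E.t) := by
        rw [mul_assoc, ← mul_assoc E.t, E.conj, E.map_add]
        simp only [mul_assoc]
      have h2 : E.φ b * E.t * (E.φ c * E.t) = E.φ (b + E.σ c) * (E.t * E.t) := by
        rw [mul_assoc, ← mul_assoc E.t, E.conj, E.map_add]
        simp only [mul_assoc]
      rw [h1, h2] at hg
      have := E.injective (mul_right_cancel hg)
      refine ⟨a - c, ?_⟩
      rw [map_sub, E.δ_apply, E.δ_apply, ← sub_eq_zero]
      have h3 : b = c + E.σ a - E.σ c := eq_sub_of_add_eq this.symm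
      rw [h3]
      abel
  · rintro ⟨c, hc⟩
    have hb : b = a + E.δ c := by rw [hc]; abel
    refine ⟨E.φ (-c), ?_⟩
    rw [mul_inv_eq_iff_eq_mul, mul_assoc, E.conj, ← mul_assoc, ← mul_assoc, ← E.map_add,
      ← E.map_add, hb, E.δ_apply, _root_.map_neg]
    congr 2
    abel

theorem not_isConj (a b : A) : ¬ IsConj (E.φ a) (E.φ b * E.t) := by
  rw [isConj_iff]
  rintro ⟨g, hg⟩
  rcases E.cover g with ⟨c, rfl⟩ | ⟨c, rfl⟩
  · rw [← E.map_neg, ← E.map_add, ← E.map_add] at hg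
    exact E.ne_mul _ _ hg
  · obtain ⟨s, hs⟩ := E.t_sq
    rw [mul_inv_eq_iff_eq_mul, mul_assoc, E.conj, ← mul_assoc, mul_assoc (E.φ b), ← mul_assoc E.t,
      E.conj, mul_assoc _ E.t E.t, ← hs, ← E.map_add, ← E.map_add, ← E.map_add] at hg
    exact E.ne_mul _ _ hg.symm

theorem commute_φ_mul_t_iff (a b : A) :
    E.φ a * (E.φ b * E.t) = E.φ b * E.t * E.φ a ↔ E.δ a = 0 := by
  rw [mul_assoc, E.conj, ← mul_assoc, ← mul_assoc, ← E.map_add, ← E.map_add, E.δ_apply, sub_eq_zero]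
  constructor
  · intro h
    have := E.mul_t_injective h
    rw [add_comm] at this
    exact (add_left_cancel this).symm
  · intro h
    rw [h, add_comm]

/-- Since `(a t)(b t) = (a + σ b) t²`, commuting means `a + σ b = b + σ a`. -/
theorem commute_mul_t_mul_t_iff (a b : A) :
    E.φ a * E.t * (E.φ b * E.t) = E.φ b * E.t * (E.φ a * E.t) ↔ a - b ∈ E.δ.ker := by
  have key : ∀ a b, E.φ a * E.t * (E.φ b * E.t) = E.φ (a + E.σ b) * (E.t * E.t) := by
    intro a b
    rw [mul_assoc, ← mul_assoc E.t, E.conj, E.map_add]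
    simp only [mul_assoc]
  rw [key, key, mul_left_inj, E.injective.eq_iff, AddMonoidHom.mem_ker, map_sub, E.δ_apply,
    E.δ_apply, ← sub_eq_zero, ← neg_eq_zero]
  constructor <;> intro h <;> rw [← h] <;> abel

theorem φ_mem_noncenter_iff (a : A) :
    ConjClasses.mk (E.φ a) ∈ ConjClasses.noncenter G ↔ E.δ a ≠ 0 := by
  rw [ConjClasses.mk_mem_noncenter_iff, E.δ_apply, sub_ne_zero]
  constructor
  · rintro ⟨h, hc, hne⟩
    rcases E.cover h with ⟨b, rfl⟩ | ⟨b, rfl⟩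
    · rcases (E.isConj_φ_iff a b).1 hc with rfl | rfl
      · exact absurd rfl hne
      · exact fun h => hne (congrArg _ h)
    · exact absurd hc (E.not_isConj a b)
  · intro h
    exact ⟨E.φ (E.σ a), (E.isConj_φ_iff _ _).2 (.inr rfl), fun h' => h (E.injective h')⟩

theorem mul_t_mem_noncenter (hE : E.δ ≠ 0) (a : A) :
    ConjClasses.mk (E.φ a * E.t) ∈ ConjClasses.noncenter G := by
  obtain ⟨c, hc⟩ := DFunLike.ne_iff.1 hE
  refine ConjClasses.mk_mem_noncenter_iff.2 ⟨E.φ (a + E.δ c) * E.t,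
    (E.isConj_mul_t_iff _ _).2 ⟨c, by abel⟩, fun h => hc ?_⟩
  have := E.mul_t_injective h
  rwa [add_eq_left] at this

/-- The subgroup whose cosets label the components of the graph on the classes outside the
abelian subgroup. -/
def H : AddSubgroup A := E.δ.ker ⊔ E.δ.range

open scoped Classical in
/-- The label of the component of an element. -/
noncomputable def label (g : G) : Option (A ⧸ E.H) :=
  if h : ∃ a, E.φ a * E.t = g then some (QuotientAddGroup.mk h.choose) else none

theorem label_φ (a : A) : E.label (E.φ a) = none := by
  unfold label
  rw [dif_neg]
  rintro ⟨b, hb⟩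
  exact E.ne_mul a b hb.symm

theorem label_mul_t (a : A) : E.label (E.φ a * E.t) = some (QuotientAddGroup.mk a) := by
  unfold label
  have h : ∃ b, E.φ b * E.t = E.φ a * E.t := ⟨a, rfl⟩
  rw [dif_pos h, E.mul_t_injective h.choose_spec]

theorem label_eq_of_isConj {g h : G} (hc : IsConj g h) : E.label g = E.label h := by
  rcases E.cover g with ⟨a, rfl⟩ | ⟨a, rfl⟩ <;> rcases E.cover h with ⟨b, rfl⟩ | ⟨b, rfl⟩
  · rw [label_φ, label_φ]
  · exact absurd hc (E.not_isConj _ _)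
  · exact absurd hc.symm (E.not_isConj _ _)
  · rw [label_mul_t, label_mul_t, Option.some_inj, QuotientAddGroup.eq, neg_add_eq_sub]
    exact (le_sup_right : _ ≤ E.H) ((E.isConj_mul_t_iff a b).1 hc)

/-- The label of the component of a vertex. -/
noncomputable def vertexLabel (v : CCCVertex G) : Option (A ⧸ E.H) := E.label v.1.out

theorem vertexLabel_mk (g : G) (hg : ConjClasses.mk g ∈ ConjClasses.noncenter G) :
    E.vertexLabel (CCCVertex.mk g hg) = E.label g :=
  E.label_eq_of_isConj (ConjClasses.mk_eq_mk_iff_isConj.1 (Quotient.out_eq _))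

theorem adj_iff (v w : CCCVertex G) :
    (cccGraph G).Adj v w ↔ v ≠ w ∧ E.vertexLabel v = E.vertexLabel w := by
  refine and_congr_right fun hne => ?_
  constructor
  · rintro ⟨g, hg, h, hh, e⟩
    rw [ConjClasses.mem_carrier_iff_mk_eq] at hg hh
    have hv := v.2
    have hw := w.2
    rw [← hg] at hv
    rw [← hh] at hw
    obtain rfl : CCCVertex.mk g hv = v := Subtype.ext hg
    obtain rfl : CCCVertex.mk h hw = w := Subtype.ext hh
    rw [vertexLabel_mk, vertexLabel_mk]
    rcases E.cover g with ⟨a, rfl⟩ | ⟨a, rfl⟩ <;> rcases E.cover h with ⟨b, rfl⟩ | ⟨b, rfl⟩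
    · rw [label_φ, label_φ]
    · exact absurd ((E.commute_φ_mul_t_iff a b).1 e) ((E.φ_mem_noncenter_iff a).1 hv)
    · exact absurd ((E.commute_φ_mul_t_iff b a).1 e.symm) ((E.φ_mem_noncenter_iff b).1 hw)
    · rw [label_mul_t, label_mul_t, Option.some_inj, eq_comm, QuotientAddGroup.eq, neg_add_eq_sub]
      exact (le_sup_left : _ ≤ E.H) ((E.commute_mul_t_mul_t_iff a b).1 e)
  · obtain ⟨g, hv, rfl⟩ := v.exists_mk
    obtain ⟨h, hw, rfl⟩ := w.exists_mk
    rw [vertexLabel_mk, vertexLabel_mk]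
    have key : ∀ k, IsConj h k → g * k = k * g → ∃ g' ∈ (CCCVertex.mk g hv).1.carrier,
        ∃ h' ∈ (CCCVertex.mk h hw).1.carrier, g' * h' = h' * g' := fun k hk e =>
      ⟨g, ConjClasses.mem_carrier_mk, k, ConjClasses.mem_carrier_iff_mk_eq.2
        (ConjClasses.mk_eq_mk_iff_isConj.2 hk.symm), e⟩
    rcases E.cover g with ⟨a, rfl⟩ | ⟨a, rfl⟩ <;> rcases E.cover h with ⟨b, rfl⟩ | ⟨b, rfl⟩
    · exact fun _ => key _ (IsConj.refl _) (by rw [← E.map_add, ← E.map_add, add_comm])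
    · rw [label_φ, label_mul_t]
      exact nofun
    · rw [label_φ, label_mul_t]
      exact nofun
    · rw [label_mul_t, label_mul_t, Option.some_inj, eq_comm, QuotientAddGroup.eq, neg_add_eq_sub]
      intro hab
      -- Split `a - b = k + d` with `k` central and `d` in the range of `δ`: then `(b + d) t` is
      -- conjugate to `b t` and commutes with `a t`.
      obtain ⟨k, hk, d, hd, e⟩ := AddSubgroup.mem_sup.1 hab
      refine key (E.φ (b + d) * E.t) ?_ ?_
      · rw [E.isConj_mul_t_iff]
        simpa using hd
      · rw [E.commute_mul_t_mul_t_iff]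
        have : a - (b + d) = k := by rw [← sub_sub, ← e, add_sub_cancel_right]
        rwa [this]

variable [Finite A]

/-- Sending a non-central `a` to its class is two-to-one, because the class is `{a, σ a}` with `σ a
≠ a`. -/
theorem card_ker_add_two_mul [Finite G] :
    Nat.card A = Nat.card E.δ.ker + 2 * Nat.card {v // E.vertexLabel v = none} := by
  classical
  have := Fintype.ofFinite A
  let g : {a // ¬ E.δ a = 0} → {v // E.vertexLabel v = none} := fun a =>
    ⟨CCCVertex.mk (E.φ a) ((E.φ_mem_noncenter_iff a).2 a.2),
      (E.vertexLabel_mk _ _).trans (E.label_φ a)⟩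
  have hg : ∀ y, Nat.card {x // g x = y} = 2 := by
    rintro ⟨v, hv⟩
    obtain ⟨k, hc, rfl⟩ := v.exists_mk
    rcases E.cover k with ⟨a, rfl⟩ | ⟨a, rfl⟩
    swap
    · rw [vertexLabel_mk, label_mul_t] at hv
      exact absurd hv nofun
    have ha := (E.φ_mem_noncenter_iff a).1 hc
    have hσ : E.δ (E.σ a) ≠ 0 := by
      rw [E.δ_apply, E.σ_σ, ← neg_sub, ← E.δ_apply]
      exact neg_ne_zero.2 ha
    have hset : {x | g x = ⟨CCCVertex.mk (E.φ a) hc, hv⟩} = {⟨a, ha⟩, ⟨E.σ a, hσ⟩} := by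
      ext ⟨b, hb⟩
      simp only [Set.mem_ofPred_eq, Set.mem_insert_iff, Set.mem_singleton_iff, Subtype.mk.injEq, g]
      rw [CCCVertex.mk_eq_mk_iff, isConj_comm, E.isConj_φ_iff]
    change Nat.card ({x | g x = ⟨CCCVertex.mk (E.φ a) hc, hv⟩} : Set _) = 2
    rw [hset, Nat.card_coe_set_eq, Set.ncard_pair]
    intro h
    rw [Subtype.mk.injEq] at h
    exact ha (by rw [E.δ_apply, ← h, sub_self])
  have : Finite (CCCVertex G) := Finite.of_fintype _
  rw [← Nat.card_eq_mul_card_of_fibers g 2 hg]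
  change _ = Nat.card {a // E.δ a = 0} + _
  simp only [Nat.card_eq_fintype_card]
  rw [Fintype.card_subtype_compl]
  have := Fintype.card_subtype_le (fun a => E.δ a = 0)
  omega

/-- After choosing a representative `a₀` of the coset, `a ↦ (a₀ + a) t` maps `H` onto the classes of
the component, and its fibres are translates of the range of `δ`. -/
theorem card_fiber_some [Finite G] (hE : E.δ ≠ 0) (c : A ⧸ E.H) :
    Nat.card E.H = Nat.card E.δ.range * Nat.card {v // E.vertexLabel v = some c} := by
  have : Finite (CCCVertex G) := Finite.of_fintype _
  obtain ⟨a₀, rfl⟩ := QuotientAddGroup.mk_surjective c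
  let g : E.H → {v // E.vertexLabel v = some (QuotientAddGroup.mk a₀)} := fun a =>
    ⟨CCCVertex.mk (E.φ (a₀ + a) * E.t) (E.mul_t_mem_noncenter hE _), by
      rw [vertexLabel_mk, label_mul_t, Option.some_inj, eq_comm, QuotientAddGroup.eq,
        neg_add_cancel_left]
      exact a.2⟩
  refine Nat.card_eq_mul_card_of_fibers g _ ?_
  rintro ⟨v, hv⟩
  obtain ⟨k, hc, rfl⟩ := v.exists_mk
  rcases E.cover k with ⟨a, rfl⟩ | ⟨a, rfl⟩
  · rw [vertexLabel_mk, label_φ] at hv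
    exact absurd hv nofun
  have hv' := hv
  rw [vertexLabel_mk, label_mul_t, Option.some_inj, eq_comm, QuotientAddGroup.eq] at hv'
  have hD : ∀ d : E.δ.range, (-a₀ + a + d : A) ∈ E.H := fun d =>
    add_mem hv' ((le_sup_right : _ ≤ E.H) d.2)
  have hiff : ∀ b : E.H, g b = ⟨CCCVertex.mk (E.φ a * E.t) hc, hv⟩ ↔
      (a₀ + b : A) - a ∈ E.δ.range := by
    intro b
    rw [← E.isConj_mul_t_iff, isConj_comm, Subtype.mk.injEq, CCCVertex.mk_eq_mk_iff]
  refine Nat.card_congr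
    { toFun := fun b => ⟨_, (hiff b.1).1 b.2⟩
      invFun := fun d => ⟨⟨_, hD d⟩, (hiff _).2 (by
        have : a₀ + (-a₀ + a + d) - a = (d : A) := by abel
        simp only [this]
        exact d.2)⟩
      left_inv := fun b => by
        apply Subtype.ext
        apply Subtype.ext
        change -a₀ + a + (a₀ + (b.1 : A) - a) = b.1
        abel
      right_inv := fun d => by
        apply Subtype.ext
        change a₀ + (-a₀ + a + (d : A)) - a = d
        abel }

theorem isCliqueUnion [Finite G] (hE : E.δ ≠ 0) {p r q : ℕ} (hr : E.H.index = r)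
    (hz : Nat.card E.δ.ker = r * q) (hp : Nat.card A = r * q + 2 * p) :
    (cccGraph G).IsCliqueUnion p r q := by
  have e : A ⧸ E.H ≃ Fin r := Finite.equivFinOfCardEq hr
  have hmap : ∀ v c, (E.vertexLabel v).map e = c ↔ E.vertexLabel v = c.map e.symm := by
    intro v c
    constructor
    · rintro rfl
      simp
    · intro h
      simp [h]
  refine ⟨fun v => (E.vertexLabel v).map e, ?_, ?_, fun k => ?_⟩
  · intro v w
    rw [E.adj_iff, (Option.map_injective e.injective).eq_iff]
  · simp only [hmap, Option.map_none]
    have := E.card_ker_add_two_mul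
    omega
  · simp only [hmap, Option.map_some]
    have h1 := E.card_fiber_some hE (e.symm k)
    have h2 : Nat.card E.H * r = Nat.card A := hr ▸ E.H.card_mul_index
    have h3 : Nat.card E.δ.ker * Nat.card E.δ.range = Nat.card A := by
      rw [← E.δ.ker.card_mul_index, AddSubgroup.index_ker]
    have hr0 : 0 < r := hr ▸ Nat.pos_of_ne_zero AddSubgroup.index_ne_zero_of_finite
    have hd0 : 0 < Nat.card E.δ.range := Nat.card_pos
    -- Comparing `|H| r = |A| = |ker δ| |range δ|` with `|H| = |range δ| · (component size)` and
    -- `|ker δ| = r q` leaves component size `q`.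
    rw [← h3, hz, h1] at h2
    have h4 : (Nat.card E.δ.range * r) * Nat.card {v // E.vertexLabel v = some (e.symm k)} =
        (Nat.card E.δ.range * r) * q := by linarith
    exact Nat.eq_of_mul_eq_mul_left (Nat.mul_pos hd0 hr0) h4

end AbelianIndexTwo

/-! ### Explicit extensions by an involution, and the presented groups -/

/-- An automorphism `σ` of order at most two of an abelian group, and an element `c` that it
fixes. -/
structure TwistData (A : Type*) [AddCommGroup A] where
  σ : A →+ A
  c : A
  σ_σ : ∀ a, σ (σ a) = a
  σ_c : σ c = c

namespace TwistData

variable {A : Type*} [AddCommGroup A]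

/-- The extension of the abelian group `A` by an element `t` that acts on `A` as `σ`, with
`t ^ 2 = c`. -/
inductive Ext (T : TwistData A) : Type _
  | base : A → Ext T
  | twist : A → Ext T

namespace Ext

variable {T : TwistData A}

/-- Multiplication in the extension. -/
protected def mul : T.Ext → T.Ext → T.Ext
  | base a, base b => base (a + b)
  | base a, twist b => twist (a + b)
  | twist a, base b => twist (a + T.σ b)
  | twist a, twist b => base (a + T.σ b + T.c)

/-- Inversion in the extension. -/
protected def inv : T.Ext → T.Ext
  | base a => base (-a)
  | twist a => twist (-T.σ a - T.c)

instance : Mul T.Ext := ⟨Ext.mul⟩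

instance : One T.Ext := ⟨base 0⟩

instance : Inv T.Ext := ⟨Ext.inv⟩

theorem one_def : (1 : T.Ext) = base 0 := rfl

theorem base_mul_base (a b : A) : (base a * base b : T.Ext) = base (a + b) := rfl

theorem base_mul_twist (a b : A) : (base a * twist b : T.Ext) = twist (a + b) := rfl

theorem twist_mul_base (a b : A) : (twist a * base b : T.Ext) = twist (a + T.σ b) := rfl

theorem twist_mul_twist (a b : A) : (twist a * twist b : T.Ext) = base (a + T.σ b + T.c) := rfl

theorem base_inv (a : A) : (base a : T.Ext)⁻¹ = base (-a) := rfl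

theorem twist_inv (a : A) : (twist a : T.Ext)⁻¹ = twist (-T.σ a - T.c) := rfl

instance : Group T.Ext where
  mul_assoc := by
    rintro (a | a) (b | b) (c | c) <;>
      simp only [base_mul_base, base_mul_twist, twist_mul_base, twist_mul_twist, map_add, T.σ_σ,
        T.σ_c] <;> congr 1 <;> abel
  one_mul := by
    rintro (a | a) <;> simp only [one_def, base_mul_base, base_mul_twist, zero_add]
  mul_one := by
    rintro (a | a) <;> simp only [one_def, base_mul_base, twist_mul_base, map_zero, add_zero]
  inv_mul_cancel := by
    rintro (a | a) <;> simp only [one_def, base_inv, twist_inv, base_mul_base, twist_mul_twist] <;>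
      congr 1 <;> abel

theorem base_zpow (a : A) (k : ℤ) : (base a : T.Ext) ^ k = base (k • a) := by
  let f : Multiplicative A →* T.Ext :=
    { toFun := fun a => base a.toAdd, map_one' := rfl, map_mul' := fun _ _ => rfl }
  exact (map_zpow f (Multiplicative.ofAdd a) k).symm

theorem twist_zero_zpow_two_mul (k : ℤ) : (twist 0 : T.Ext) ^ (2 * k) = base (k • T.c) := by
  rw [zpow_mul, zpow_two, twist_mul_twist, map_zero, zero_add, zero_add, base_zpow]

theorem twist_zero_zpow_two_mul_add_one (k : ℤ) :
    (twist 0 : T.Ext) ^ (2 * k + 1) = twist (k • T.c) := by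
  rw [zpow_add, twist_zero_zpow_two_mul, zpow_one, base_mul_twist, add_zero]

end Ext

/-- A group isomorphic to the extension has an abelian subgroup of index two. -/
def abelianIndexTwo (T : TwistData A) {G : Type*} [Group G] (e : G ≃* T.Ext) :
    AbelianIndexTwo A G where
  φ a := e.symm (Ext.base a)
  t := e.symm (Ext.twist 0)
  σ := T.σ
  map_add a b := by rw [← map_mul, Ext.base_mul_base]
  injective a b h := by simpa using h
  conj a := by
    rw [← map_mul, ← map_mul, Ext.base_mul_twist, Ext.twist_mul_base, zero_add, add_zero]
  cover g := by
    rcases h : e g with a | a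
    · exact .inl ⟨a, by rw [← h, e.symm_apply_apply]⟩
    · refine .inr ⟨a, ?_⟩
      rw [← map_mul, Ext.base_mul_twist, add_zero, ← h, e.symm_apply_apply]
  ne a := by simp

end TwistData

/-- The rule only moves powers of `b` past `a`; finite order of `a` covers `a⁻¹` by turning it into
a power with natural exponent. -/
theorem exists_zpow_mul_zpow_of_closure {G : Type*} [Group G] (a b : G)
    (hgen : Subgroup.closure {a, b} = ⊤) (ha : IsOfFinOrder a)
    (h : ∀ j : ℤ, ∃ i k : ℤ, b ^ j * a = a ^ i * b ^ k) (g : G) :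
    ∃ i j : ℤ, g = a ^ i * b ^ j := by
  have hSa : ∀ g : G, (∃ i j : ℤ, g = a ^ i * b ^ j) → ∃ i j : ℤ, g * a = a ^ i * b ^ j := by
    rintro _ ⟨i, j, rfl⟩
    obtain ⟨i', k, e⟩ := h j
    exact ⟨i + i', k, by rw [mul_assoc, e, zpow_add, mul_assoc]⟩
  have hpow : ∀ (k : ℕ) (g : G), (∃ i j : ℤ, g = a ^ i * b ^ j) →
      ∃ i j : ℤ, g * a ^ k = a ^ i * b ^ j := by
    intro k
    induction k with
    | zero => intro g hg; simpa using hg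
    | succ k ih => intro g hg; rw [pow_succ, ← mul_assoc]; exact hSa _ (ih g hg)
  have hg : g ∈ Subgroup.closure {a, b} := hgen ▸ Subgroup.mem_top g
  induction hg using Subgroup.closure_induction_right with
  | one => exact ⟨0, 0, by simp⟩
  | mul_right s hs c hc ih =>
    rcases hc with rfl | rfl
    · exact hSa _ ih
    · obtain ⟨i, j, rfl⟩ := ih
      exact ⟨i, j + 1, by rw [zpow_add_one, mul_assoc]⟩
  | mul_inv_cancel s hs c hc ih =>
    rcases hc with rfl | rfl
    · obtain ⟨k, hk, e⟩ := isOfFinOrder_iff_pow_eq_one.1 ha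
      have : c⁻¹ = c ^ (k - 1) := by
        rw [inv_eq_iff_mul_eq_one, ← pow_succ', Nat.sub_add_cancel hk, e]
      rw [this]
      exact hpow _ _ ih
    · obtain ⟨i, j, rfl⟩ := ih
      exact ⟨i, j - 1, by rw [zpow_sub_one, mul_assoc]⟩

theorem PresentedGroup.bijective_toGroup {A : Type*} [AddCommGroup A] {T : TwistData A}
    {rels : Set (FreeGroup (Fin 2))} {f : Fin 2 → T.Ext}
    (hrel : ∀ r ∈ rels, FreeGroup.lift f r = 1)
    (hbase : ∀ a, ∃ g, PresentedGroup.toGroup hrel g = .base a)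
    (htwist : ∃ g, PresentedGroup.toGroup hrel g = .twist 0)
    (hinj : ∀ g, PresentedGroup.toGroup hrel g = 1 → g = 1) :
    Function.Bijective (PresentedGroup.toGroup hrel) := by
  refine ⟨(injective_iff_map_eq_one _).2 hinj, ?_⟩
  rintro (a | a)
  · exact hbase a
  · obtain ⟨g, hg⟩ := hbase a
    obtain ⟨t, ht⟩ := htwist
    exact ⟨g * t, by rw [map_mul, hg, ht, TwistData.Ext.base_mul_twist, add_zero]⟩

namespace GroupFamilies

open TwistData TwistData.Ext

theorem toGroup_x {G : Type*} [Group G] {rels : Set (FreeGroup (Fin 2))} {f : Fin 2 → G}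
    (hrel : ∀ r ∈ rels, FreeGroup.lift f r = 1) :
    PresentedGroup.toGroup hrel (PresentedGroup.mk rels x) = f 0 :=
  PresentedGroup.toGroup.of hrel

theorem toGroup_y {G : Type*} [Group G] {rels : Set (FreeGroup (Fin 2))} {f : Fin 2 → G}
    (hrel : ∀ r ∈ rels, FreeGroup.lift f r = 1) :
    PresentedGroup.toGroup hrel (PresentedGroup.mk rels y) = f 1 :=
  PresentedGroup.toGroup.of hrel

/-- `U_(n,m)` as an extension of `⟨x²⟩ × ⟨y⟩` by `x`. -/
def twistU (n m : ℕ) : TwistData (ZMod n × ZMod m) where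
  σ := (AddMonoidHom.fst _ _).prod (-AddMonoidHom.snd _ _)
  -- The generator of the first factor is `x²`, the square of the twisting element `x`.
  c := (1, 0)
  σ_σ a := by ext <;> simp
  σ_c := by ext <;> simp

/-- The relations bring every word to the form `x ^ i * y ^ j`. If its image in the extension is
trivial, then `2 n ∣ i` and `m ∣ j`, so the word is already trivial. The other two presentations are
treated in the same way. -/
theorem exists_equivU (n m : ℕ) [NeZero n] [NeZero m] : Nonempty (U n m ≃* (twistU n m).Ext) := by
  let X : (twistU n m).Ext := twist 0
  let Y : (twistU n m).Ext := base (0, 1)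
  have hX : ∀ k : ℤ, X ^ (2 * k) = base ((k : ZMod n), 0) := by
    intro k
    rw [twist_zero_zpow_two_mul]
    simp [twistU]
  have hX' : ∀ k : ℤ, X ^ (2 * k + 1) = twist ((k : ZMod n), 0) := by
    intro k
    rw [twist_zero_zpow_two_mul_add_one]
    simp [twistU]
  have hY : ∀ k : ℤ, Y ^ k = base (0, (k : ZMod m)) := by
    intro k
    rw [base_zpow]
    simp
  have hrel : ∀ r ∈ relsU n m, FreeGroup.lift ![X, Y] r = 1 := by
    rintro r (rfl | rfl | rfl)
    · have := hX n
      simp only [x, map_pow, FreeGroup.lift_apply_of, Matrix.cons_val_zero]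
      rw [one_def, ← zpow_natCast]
      push_cast
      rw [this]
      simp
    · have := hY m
      simp only [y, map_pow, FreeGroup.lift_apply_of, Matrix.cons_val_one, Matrix.cons_val_fin_one]
      rw [one_def, ← zpow_natCast, this]
      simp
    · simp only [x, y, map_mul, map_inv, FreeGroup.lift_apply_of, Matrix.cons_val_zero,
        Matrix.cons_val_one, Matrix.cons_val_fin_one, inv_inv]
      rw [one_def, twist_inv, twist_mul_base, twist_mul_twist, base_mul_base]
      congr 1
      ext <;> simp [twistU]
  have hx := PresentedGroup.one_of_mem (rels := relsU n m) (x := x ^ (2 * n)) (by simp [relsU])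
  have hy := PresentedGroup.one_of_mem (rels := relsU n m) (x := y ^ m) (by simp [relsU])
  have hr := PresentedGroup.mk_eq_mk_of_mul_inv_mem (rels := relsU n m)
    (x := x⁻¹ * y * x) (y := y⁻¹) (by simp [relsU])
  simp only [map_pow, map_mul, map_inv] at hx hy hr
  have htx := toGroup_x hrel
  have hty := toGroup_y hrel
  refine ⟨MulEquiv.ofBijective _ (PresentedGroup.bijective_toGroup hrel ?_ ⟨_, htx⟩ ?_)⟩
  · rintro ⟨i, j⟩
    obtain ⟨i, rfl⟩ := ZMod.intCast_surjective i
    obtain ⟨j, rfl⟩ := ZMod.intCast_surjective j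
    refine ⟨PresentedGroup.mk _ x ^ (2 * i) * PresentedGroup.mk _ y ^ j, ?_⟩
    rw [map_mul, map_zpow, map_zpow, htx, hty]
    change X ^ (2 * i) * Y ^ j = _
    rw [hX, hY, base_mul_base]
    simp
  · intro g hg
    have hs : SemiconjBy (PresentedGroup.mk (relsU n m) x) (PresentedGroup.mk (relsU n m) y)⁻¹
        (PresentedGroup.mk (relsU n m) y) := by
      rw [SemiconjBy, ← hr]; group
    obtain ⟨i, j, rfl⟩ := exists_zpow_mul_zpow_of_closure _ _ (closure_of (relsU n m))
      (isOfFinOrder_iff_pow_eq_one.2 ⟨_, by have := NeZero.pos n; omega, hx⟩) (fun j =>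
        ⟨1, -j, by rw [← (hs.zpow_right j).eq]; simp⟩) g
    rw [map_mul, map_zpow, map_zpow, htx, hty] at hg
    change X ^ i * Y ^ j = _ at hg
    obtain ⟨k, rfl | rfl⟩ := Int.even_or_odd' i
    · rw [hX, hY, base_mul_base, one_def, base.injEq, Prod.ext_iff] at hg
      simp only [Prod.mk_add_mk, add_zero, zero_add, Prod.fst_zero, Prod.snd_zero,
        ZMod.intCast_zmod_eq_zero_iff_dvd] at hg
      obtain ⟨⟨u, rfl⟩, ⟨v, rfl⟩⟩ := hg
      have h2 : 2 * ((n : ℤ) * u) = ((2 * n : ℕ) : ℤ) * u := by push_cast; ring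
      rw [h2, zpow_mul, zpow_mul, zpow_natCast, zpow_natCast, hx, hy, one_zpow, one_zpow, mul_one]
    · rw [hX', hY, twist_mul_base, one_def] at hg
      exact absurd hg nofun

/-- `SD_{8n}` as an extension of `⟨x⟩` by `y`. -/
def twistSD (n : ℕ) : TwistData (ZMod (4 * n)) where
  σ := AddMonoidHom.mulLeft (2 * n - 1)
  c := 0
  σ_σ a := by
    have : (4 * n : ZMod (4 * n)) = 0 := by exact_mod_cast ZMod.natCast_self (4 * n)
    simp only [AddMonoidHom.coe_mulLeft]
    -- This is `(2 n - 1)² = 1 + 4 n (n - 1)`.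
    linear_combination (n - 1 : ZMod (4 * n)) * a * this
  σ_c := map_zero _

theorem exists_equivSD (n : ℕ) [NeZero n] : Nonempty (SD n ≃* (twistSD n).Ext) := by
  let X : (twistSD n).Ext := base 1
  let Y : (twistSD n).Ext := twist 0
  have hX : ∀ k : ℤ, X ^ k = base (k : ZMod (4 * n)) := by
    intro k
    rw [base_zpow]
    simp
  have hY : ∀ k : ℤ, Y ^ (2 * k) = 1 := by
    intro k
    rw [twist_zero_zpow_two_mul]
    simp [twistSD, one_def]
  have hn : 1 ≤ 2 * n := by have := NeZero.pos n; omega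
  have hrel : ∀ r ∈ relsSD n, FreeGroup.lift ![X, Y] r = 1 := by
    rintro r (rfl | rfl | rfl)
    · have := hX (4 * n : ℕ)
      simp only [x, map_pow, FreeGroup.lift_apply_of, Matrix.cons_val_zero]
      rw [one_def, ← zpow_natCast, this, Int.cast_natCast, ZMod.natCast_self]
    · have := hY 1
      simp only [y, map_pow, FreeGroup.lift_apply_of, Matrix.cons_val_one, Matrix.cons_val_fin_one]
      exact_mod_cast this
    · have := hX (2 * n - 1 : ℕ)
      simp only [x, y, map_mul, map_inv, map_pow, FreeGroup.lift_apply_of, Matrix.cons_val_zero,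
        Matrix.cons_val_one, Matrix.cons_val_fin_one]
      rw [← zpow_natCast, this, one_def, twist_mul_base, twist_mul_twist, base_inv, base_mul_base]
      simp [twistSD, Nat.cast_sub hn]
  have hx := PresentedGroup.one_of_mem (rels := relsSD n) (x := x ^ (4 * n)) (by simp [relsSD])
  have hy := PresentedGroup.one_of_mem (rels := relsSD n) (x := y ^ 2) (by simp [relsSD])
  have hr := PresentedGroup.mk_eq_mk_of_mul_inv_mem (rels := relsSD n)
    (x := y * x * y) (y := x ^ (2 * n - 1)) (by simp [relsSD])
  simp only [map_pow, map_mul] at hx hy hr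
  have htx := toGroup_x hrel
  have hty := toGroup_y hrel
  refine ⟨MulEquiv.ofBijective _ (PresentedGroup.bijective_toGroup hrel ?_ ⟨_, hty⟩ ?_)⟩
  · intro i
    obtain ⟨i, rfl⟩ := ZMod.intCast_surjective i
    refine ⟨PresentedGroup.mk _ x ^ i, ?_⟩
    rw [map_zpow, htx]
    exact hX i
  · intro g hg
    have hs : SemiconjBy (PresentedGroup.mk (relsSD n) y)
        (PresentedGroup.mk (relsSD n) x ^ (2 * n - 1)) (PresentedGroup.mk (relsSD n) x) := by
      rw [SemiconjBy, ← hr, ← mul_assoc, ← mul_assoc, ← pow_two, hy, one_mul]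
    obtain ⟨i, j, rfl⟩ := exists_zpow_mul_zpow_of_closure _ _
      ((Set.pair_comm _ _) ▸ closure_of (relsSD n))
      (isOfFinOrder_iff_pow_eq_one.2 ⟨_, two_pos, hy⟩) (fun j =>
        ⟨1, ((2 * n - 1 : ℕ) : ℤ) * j, by rw [← (hs.zpow_right j).eq, zpow_mul]; simp⟩) g
    rw [map_mul, map_zpow, map_zpow, htx, hty] at hg
    change Y ^ i * X ^ j = _ at hg
    obtain ⟨k, rfl | rfl⟩ := Int.even_or_odd' i
    · rw [hX, hY, one_mul, one_def, base.injEq, ZMod.intCast_zmod_eq_zero_iff_dvd] at hg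
      obtain ⟨v, rfl⟩ := hg
      rw [zpow_mul, zpow_mul, zpow_natCast, hx, one_zpow, mul_one, zpow_ofNat, hy, one_zpow]
    · rw [zpow_add_one, hX, hY, one_mul, twist_mul_base, one_def] at hg
      exact absurd hg nofun

/-- `V_{8n}` as an extension of `⟨x⟩ × ⟨y²⟩` by `y`. -/
def twistV (n : ℕ) : TwistData (ZMod (2 * n) × ZMod 2) where
  -- Since `y⁴ = 1`, the relation `y x = x⁻¹ y⁻¹` reads `y x y⁻¹ = x⁻¹ y²`; thus `σ (i, j) = (-i, j
  -- + i)`.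
  σ := ((-AddMonoidHom.fst _ _).prod (AddMonoidHom.snd _ _ +
    (ZMod.castHom (dvd_mul_right 2 n) (ZMod 2)).toAddMonoidHom.comp (AddMonoidHom.fst _ _)))
  c := (0, 1)
  σ_σ a := by ext <;> simp [add_assoc, CharTwo.add_self_eq_zero]
  σ_c := by ext <;> simp

theorem exists_equivV (n : ℕ) [NeZero n] : Nonempty (V n ≃* (twistV n).Ext) := by
  let X : (twistV n).Ext := base (1, 0)
  let Y : (twistV n).Ext := twist 0
  have hX : ∀ k : ℤ, X ^ k = base ((k : ZMod (2 * n)), 0) := by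
    intro k
    rw [base_zpow]
    simp
  have hY : ∀ k : ℤ, Y ^ (2 * k) = base (0, (k : ZMod 2)) := by
    intro k
    rw [twist_zero_zpow_two_mul]
    simp [twistV]
  have hY' : ∀ k : ℤ, Y ^ (2 * k + 1) = twist (0, (k : ZMod 2)) := by
    intro k
    rw [twist_zero_zpow_two_mul_add_one]
    simp [twistV]
  have hrel : ∀ r ∈ relsV n, FreeGroup.lift ![X, Y] r = 1 := by
    rintro r (rfl | rfl | rfl | rfl)
    · have := hX (2 * n : ℕ)
      simp only [x, map_pow, FreeGroup.lift_apply_of, Matrix.cons_val_zero]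
      rw [one_def, ← zpow_natCast, this, Int.cast_natCast, ZMod.natCast_self]
      rfl
    · have := hY 2
      simp only [y, map_pow, FreeGroup.lift_apply_of, Matrix.cons_val_one, Matrix.cons_val_fin_one]
      rw [one_def, ← zpow_natCast]
      exact this
    · simp only [x, y, map_mul, map_inv, FreeGroup.lift_apply_of, Matrix.cons_val_zero,
        Matrix.cons_val_one, Matrix.cons_val_fin_one]
      rw [mul_inv_eq_one, base_inv, twist_inv, twist_mul_base, base_mul_twist]
      simp [twistV, CharTwo.add_self_eq_zero]
    · simp only [x, y, map_mul, map_inv, FreeGroup.lift_apply_of, Matrix.cons_val_zero,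
        Matrix.cons_val_one, Matrix.cons_val_fin_one]
      rw [mul_inv_eq_one, base_inv, twist_inv, twist_mul_base, base_mul_twist]
      simp [twistV, CharTwo.add_self_eq_zero]
  have hx := PresentedGroup.one_of_mem (rels := relsV n) (x := x ^ (2 * n)) (by simp [relsV])
  have hy := PresentedGroup.one_of_mem (rels := relsV n) (x := y ^ 4) (by simp [relsV])
  have hr := PresentedGroup.mk_eq_mk_of_mul_inv_mem (rels := relsV n)
    (x := y * x) (y := x⁻¹ * y⁻¹) (by simp [relsV])
  have ht := PresentedGroup.mk_eq_mk_of_mul_inv_mem (rels := relsV n)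
    (x := y⁻¹ * x) (y := x⁻¹ * y) (by simp [relsV])
  simp only [map_pow, map_mul, map_inv] at hx hy hr ht
  have htx := toGroup_x hrel
  have hty := toGroup_y hrel
  refine ⟨MulEquiv.ofBijective _ (PresentedGroup.bijective_toGroup hrel ?_ ⟨_, hty⟩ ?_)⟩
  · rintro ⟨i, j⟩
    obtain ⟨i, rfl⟩ := ZMod.intCast_surjective i
    obtain ⟨j, rfl⟩ := ZMod.intCast_surjective j
    refine ⟨PresentedGroup.mk _ x ^ i * PresentedGroup.mk _ y ^ (2 * j), ?_⟩
    rw [map_mul, map_zpow, map_zpow, htx, hty]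
    change X ^ i * Y ^ (2 * j) = _
    rw [hX, hY, base_mul_base]
    simp
  · intro g hg
    have hcl := closure_of (relsV n)
    have hxf : IsOfFinOrder (PresentedGroup.mk (relsV n) x) :=
      isOfFinOrder_iff_pow_eq_one.2 ⟨_, by have := NeZero.pos n; omega, hx⟩
    have hnf : ∀ j : ℤ, ∃ i k : ℤ, PresentedGroup.mk (relsV n) y ^ j * PresentedGroup.mk (relsV n) x
        = PresentedGroup.mk (relsV n) x ^ i * PresentedGroup.mk (relsV n) y ^ k := by
      intro j
      clear hg g hcl hxf htx hty
      generalize PresentedGroup.mk (relsV n) x = a at *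
      generalize PresentedGroup.mk (relsV n) y = b at *
      have hinv : b * a⁻¹ = a * b⁻¹ := by
        have := congrArg (·⁻¹) ht
        simp only [mul_inv_rev, inv_inv] at this
        calc b * a⁻¹ = b * (a⁻¹ * b) * b⁻¹ := by group
          _ = a * b⁻¹ := by rw [← ht]; group
      have hb4 : b ^ (4 : ℤ) = 1 := by exact_mod_cast hy
      have hsq : SemiconjBy a (b ^ (2 : ℤ)) (b ^ (2 : ℤ)) := by
        have h1 : b ^ (2 : ℤ) * a = a * b ^ (-2 : ℤ) := by
          calc b ^ (2 : ℤ) * a = b * (b * a) := by rw [zpow_two, mul_assoc]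
            _ = b * a⁻¹ * b⁻¹ := by rw [hr, mul_assoc]
            _ = a * b ^ (-2 : ℤ) := by rw [hinv]; group
        have h2 : b ^ (-2 : ℤ) = b ^ (2 : ℤ) := by
          rw [show (-2 : ℤ) = 2 - 4 by norm_num, zpow_sub, hb4]; simp
        rw [SemiconjBy, h1, h2]
      obtain ⟨k, rfl | rfl⟩ := Int.even_or_odd' j
      · refine ⟨1, 2 * k, ?_⟩
        have := (hsq.zpow_right k).eq
        rw [← zpow_mul] at this
        rw [← this, zpow_one]
      · refine ⟨-1, 2 * k - 1, ?_⟩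
        have := (hsq.inv_symm_left.zpow_right k).eq
        rw [← zpow_mul] at this
        rw [zpow_add, zpow_one, mul_assoc, hr, ← mul_assoc, ← this, zpow_sub, zpow_neg,
          zpow_one, zpow_one, mul_assoc]
    obtain ⟨i, j, rfl⟩ := exists_zpow_mul_zpow_of_closure _ _ hcl hxf hnf g
    rw [map_mul, map_zpow, map_zpow, htx, hty] at hg
    change X ^ i * Y ^ j = _ at hg
    obtain ⟨k, rfl | rfl⟩ := Int.even_or_odd' j
    · rw [hX, hY, base_mul_base, one_def, base.injEq, Prod.ext_iff] at hg
      simp only [Prod.mk_add_mk, add_zero, zero_add, Prod.fst_zero, Prod.snd_zero,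
        ZMod.intCast_zmod_eq_zero_iff_dvd] at hg
      obtain ⟨⟨u, rfl⟩, ⟨v, rfl⟩⟩ := hg
      have h4 : 2 * (((2 : ℕ) : ℤ) * v) = ((4 : ℕ) : ℤ) * v := by push_cast; ring
      rw [h4, zpow_mul, zpow_mul, zpow_natCast, zpow_natCast, hx, hy, one_zpow, one_zpow, mul_one]
    · rw [hX, hY', base_mul_twist, one_def] at hg
      exact absurd hg nofun

end GroupFamilies

/-! ### Kernel and range of an endomorphism of a finite cyclic group -/

namespace ZMod

theorem range_eq_zmultiples {N : ℕ} {B : Type*} [AddGroup B] (f : ZMod N →+ B) :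
    f.range = AddSubgroup.zmultiples (f 1) := by
  ext a
  rw [AddSubgroup.mem_zmultiples_iff]
  constructor
  · rintro ⟨i, rfl⟩
    obtain ⟨i, rfl⟩ := ZMod.intCast_surjective i
    exact ⟨i, by rw [← map_zsmul, zsmul_one]⟩
  · rintro ⟨k, rfl⟩
    exact ⟨(k : ZMod N), by rw [← map_zsmul, zsmul_one]⟩

variable {N : ℕ} [NeZero N] (f : ZMod N →+ ZMod N) {k : ℕ}

theorem card_ker_of_map_one (hk : f 1 = k) : Nat.card f.ker = N.gcd k := by
  have h1 : Nat.card f.ker * Nat.card f.range = N := by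
    rw [← AddSubgroup.index_ker, f.ker.card_mul_index, Nat.card_zmod]
  rw [range_eq_zmultiples, Nat.card_zmultiples, hk, ZMod.addOrderOf_coe _ (NeZero.ne N)] at h1
  have h2 : N.gcd k * (N / N.gcd k) = N := Nat.mul_div_cancel' (Nat.gcd_dvd_left N k)
  have h3 : 0 < N / N.gcd k :=
    Nat.div_pos (Nat.gcd_le_left _ (NeZero.pos N)) (Nat.gcd_pos_of_pos_left _ (NeZero.pos N))
  exact Nat.eq_of_mul_eq_mul_right h3 (h1.trans h2.symm)

/-- The map is multiplication by `k`. With `g = gcd(N, k)` its kernel is generated by `N / g` and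
its range by `g`, so their sum is generated by the gcd of these two divisors. -/
theorem index_ker_sup_range_of_map_one (hk : f 1 = k) :
    (f.ker ⊔ f.range).index = (N.gcd k).gcd (N / N.gcd k) := by
  set g := N.gcd k with hg
  set d := g.gcd (N / g) with hd
  have hgN : g ∣ N := Nat.gcd_dvd_left N k
  have hgk : g ∣ k := Nat.gcd_dvd_right N k
  have hdN : d ∣ N := (Nat.gcd_dvd_left _ _).trans hgN
  have hg0 : 0 < g := Nat.gcd_pos_of_pos_left _ (NeZero.pos N)
  have hd0 : 0 < d := Nat.gcd_pos_of_pos_left _ hg0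
  have hf : ∀ i : ℤ, f i = ((i * k : ℤ) : ZMod N) := by
    intro i
    rw [← zsmul_one, map_zsmul, hk]
    simp
  have hH : f.ker ⊔ f.range = AddSubgroup.zmultiples (d : ZMod N) := by
    apply le_antisymm
    · refine sup_le ?_ ?_
      · intro a ha
        obtain ⟨i, rfl⟩ := ZMod.intCast_surjective a
        rw [AddMonoidHom.mem_ker, hf, ZMod.intCast_zmod_eq_zero_iff_dvd] at ha
        have h1 : ((N / g : ℕ) : ℤ) ∣ i * ((k / g : ℕ) : ℤ) := by
          refine (mul_dvd_mul_iff_right (c := (g : ℤ)) (by exact_mod_cast hg0.ne')).1 ?_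
          rw [mul_assoc]
          exact_mod_cast (by rwa [Nat.div_mul_cancel hgN, Nat.div_mul_cancel hgk])
        have h2 : IsCoprime ((N / g : ℕ) : ℤ) ((k / g : ℕ) : ℤ) :=
          Nat.isCoprime_iff_coprime.2 (Nat.coprime_div_gcd_div_gcd hg0)
        obtain ⟨j, hj⟩ := (Int.natCast_dvd_natCast.2 (Nat.gcd_dvd_right g (N / g))).trans
          (h2.dvd_of_dvd_mul_right h1)
        rw [AddSubgroup.mem_zmultiples_iff]
        refine ⟨j, ?_⟩
        rw [hj]
        push_cast
        rw [zsmul_eq_mul, mul_comm]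
      · rw [range_eq_zmultiples, AddSubgroup.zmultiples_le, hk]
        obtain ⟨j, hj⟩ := (Nat.gcd_dvd_left g (N / g)).trans hgk
        rw [AddSubgroup.mem_zmultiples_iff]
        refine ⟨j, ?_⟩
        rw [hj]
        push_cast
        rw [zsmul_eq_mul, mul_comm, Int.cast_natCast]
    · rw [AddSubgroup.zmultiples_le]
      have hgr : (g : ZMod N) ∈ f.ker ⊔ f.range := by
        -- The Bézout coefficient of `k` is a preimage of `g`, because the multiple of `N` vanishes.
        refine (le_sup_right : f.range ≤ _) ⟨((N.gcdB k : ℤ) : ZMod N), ?_⟩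
        rw [hf]
        have := congrArg (Int.cast (R := ZMod N)) (Nat.gcd_eq_gcd_ab N k)
        rw [← hg] at this
        push_cast at this ⊢
        rw [this, ZMod.natCast_self, zero_mul, zero_add, mul_comm]
      have hNr : ((N / g : ℕ) : ZMod N) ∈ f.ker ⊔ f.range := by
        refine (le_sup_left : f.ker ≤ _) ?_
        have := hf (N / g : ℕ)
        rw [AddMonoidHom.mem_ker]
        rw [Int.cast_natCast] at this
        rw [this, ZMod.intCast_zmod_eq_zero_iff_dvd]
        obtain ⟨j, hj⟩ := hgk
        refine ⟨j, ?_⟩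
        have h2 : ((N / g : ℕ) : ℤ) * g = N := by exact_mod_cast Nat.div_mul_cancel hgN
        rw [hj]
        push_cast at h2 ⊢
        rw [← mul_assoc, h2]
      have := congrArg (Int.cast (R := ZMod N)) (Nat.gcd_eq_gcd_ab g (N / g))
      rw [← hd, Int.cast_natCast] at this
      rw [this]
      push_cast
      refine add_mem ?_ ?_
      · rw [mul_comm, ← zsmul_eq_mul]
        exact zsmul_mem hgr _
      · rw [mul_comm, ← zsmul_eq_mul]
        exact zsmul_mem (by exact_mod_cast hNr) _
  have h3 : Nat.card (AddSubgroup.zmultiples (d : ZMod N)) = N / d := by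
    rw [Nat.card_zmultiples, ZMod.addOrderOf_coe _ (NeZero.ne N), Nat.gcd_eq_right hdN]
  have h4 := (AddSubgroup.zmultiples (d : ZMod N)).card_mul_index
  rw [h3, Nat.card_zmod] at h4
  rw [hH]
  exact Nat.eq_of_mul_eq_mul_left (Nat.div_pos (Nat.le_of_dvd (NeZero.pos N) hdN) hd0)
    (h4.trans (Nat.div_mul_cancel hdN).symm)

end ZMod

/-! ### Clique sizes and energies of the families -/

namespace AbelianIndexTwo

/-- Here `g` is the order of the centre, and `g < N` says that `G` is not abelian. -/
theorem isCliqueUnion_of_cyclic {N : ℕ} [NeZero N] {G : Type*} [Group G] [Finite G]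
    (E : AbelianIndexTwo (ZMod N) G) {k g p r q : ℕ} (hk : E.δ 1 = k) (hg : N.gcd k = g)
    (hgN : g < N) (hr : g.gcd (N / g) = r) (hq : g = r * q) (hp : N = g + 2 * p) :
    (cccGraph G).IsCliqueUnion p r q := by
  refine E.isCliqueUnion ?_ ?_ ?_ ?_
  · intro h
    rw [h, AddMonoidHom.zero_apply, eq_comm, ZMod.natCast_eq_zero_iff] at hk
    rw [Nat.gcd_eq_left hk] at hg
    omega
  · rw [H, ZMod.index_ker_sup_range_of_map_one _ hk, hg, hr]
  · rw [ZMod.card_ker_of_map_one _ hk, hg, hq]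
  · rw [Nat.card_zmod, ← hq, ← hp]

end AbelianIndexTwo

/-- The rotations in a dihedral group. -/
def DihedralGroup.abelianIndexTwo (n : ℕ) : AbelianIndexTwo (ZMod n) (DihedralGroup n) where
  φ := .r
  t := .sr 0
  σ := -AddMonoidHom.id _
  map_add a b := (DihedralGroup.r_mul_r a b).symm
  injective a b h := by simpa using h
  conj a := by simp
  cover := by
    rintro (a | a)
    · exact .inl ⟨a, rfl⟩
    · exact .inr ⟨-a, by simp⟩
  ne a := nofun

/-- The cyclic subgroup of index two in a dicyclic group. -/
def QuaternionGroup.abelianIndexTwo (n : ℕ) :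
    AbelianIndexTwo (ZMod (2 * n)) (QuaternionGroup n) where
  φ := .a
  t := .xa 0
  σ := -AddMonoidHom.id _
  map_add a b := (QuaternionGroup.a_mul_a a b).symm
  injective a b h := by simpa using h
  conj a := by simp
  cover := by
    rintro (a | a)
    · exact .inl ⟨a, rfl⟩
    · exact .inr ⟨-a, by simp⟩
  ne a := nofun

theorem DihedralGroup.δ_one {n : ℕ} (hn : 2 ≤ n) :
    (DihedralGroup.abelianIndexTwo n).δ 1 = (n - 2 : ℕ) := by
  rw [AbelianIndexTwo.δ_apply, Nat.cast_sub hn]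
  simp [abelianIndexTwo]
  ring

theorem QuaternionGroup.δ_one {n : ℕ} (hn : 1 ≤ n) :
    (QuaternionGroup.abelianIndexTwo n).δ 1 = (2 * n - 2 : ℕ) := by
  rw [AbelianIndexTwo.δ_apply, Nat.cast_sub (by omega), ZMod.natCast_self]
  simp [abelianIndexTwo]
  ring

theorem Nat.gcd_self_sub_two {n : ℕ} (hn : 2 ≤ n) : n.gcd (n - 2) = n.gcd 2 := by
  obtain ⟨k, rfl⟩ := Nat.exists_eq_add_of_le hn
  rw [Nat.add_sub_cancel_left, Nat.gcd_comm, Nat.gcd_add_self_right, Nat.gcd_self_add_left]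

theorem Nat.gcd_two_eq_one {n : ℕ} (hn : n % 2 = 1) : n.gcd 2 = 1 :=
  Nat.coprime_two_right.2 (Nat.odd_iff.2 hn)

theorem Nat.gcd_two_eq_two {n : ℕ} (hn : n % 2 = 0) : n.gcd 2 = 2 :=
  Nat.gcd_eq_right (Nat.dvd_of_mod_eq_zero hn)

/-- If `Γ` has equal energies in the case `P` and increasing energies otherwise, then these
properties characterize `P` and its negation. -/
theorem energies_dichotomy {G : Type*} [Group G] [Finite G] {P : Prop}
    (h1 : P → CNEnergiesEqual G) (h2 : ¬ P → CNEnergiesIncreasing G) :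
    (CNEnergiesEqual G ↔ P) ∧ (CNEnergiesIncreasing G ↔ ¬ P) := by
  have h3 : CNEnergiesEqual G → ¬ CNEnergiesIncreasing G := fun h h' => h'.1.ne h.1
  tauto

open SimpleGraph

theorem dihedral_energies (n : ℕ) [NeZero n] (hn : 3 ≤ n) :
    (CNEnergiesEqual (DihedralGroup n) ↔ n = 3 ∨ n = 4 ∨ n = 5 ∨ n = 6) ∧
      (CNEnergiesIncreasing (DihedralGroup n) ↔ ¬ (n = 3 ∨ n = 4 ∨ n = 5 ∨ n = 6)) := by
  have hd := DihedralGroup.δ_one (n := n) (by omega)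
  have hg := Nat.gcd_self_sub_two (n := n) (by omega)
  rcases Nat.mod_two_eq_zero_or_one n with h | h
  · rw [Nat.gcd_two_eq_two h] at hg
    -- The centre has order two; it gives two components of size one or one of size two according to
    -- `gcd(2, n / 2)`.
    rcases Nat.mod_two_eq_zero_or_one (n / 2) with h' | h'
    · have hu : (cccGraph (DihedralGroup n)).IsCliqueUnion (n / 2 - 1) 2 1 :=
        AbelianIndexTwo.isCliqueUnion_of_cyclic _ hd hg (by omega)
          (by rw [Nat.gcd_comm, Nat.gcd_two_eq_two h']) rfl (by omega)
      exact energies_dichotomy (fun hP => hu.energies_eq_of_small (by omega) (by omega))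
        fun hP => hu.energies_lt (by omega) (by omega) (by omega) (by omega)
    · have hu : (cccGraph (DihedralGroup n)).IsCliqueUnion (n / 2 - 1) 1 2 :=
        AbelianIndexTwo.isCliqueUnion_of_cyclic _ hd hg (by omega)
          (by rw [Nat.gcd_comm, Nat.gcd_two_eq_one h']) rfl (by omega)
      exact energies_dichotomy (fun hP => hu.energies_eq_of_small (by omega) (by omega))
        fun hP => hu.energies_lt (by omega) (by omega) (by omega) (by omega)
  · rw [Nat.gcd_two_eq_one h] at hg
    have hu : (cccGraph (DihedralGroup n)).IsCliqueUnion (n / 2) 1 1 :=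
      AbelianIndexTwo.isCliqueUnion_of_cyclic _ hd hg (by omega) (by simp) rfl (by omega)
    exact energies_dichotomy (fun hP => hu.energies_eq_of_small (by omega) (by omega))
      fun hP => hu.energies_lt (by omega) (by omega) (by omega) (by omega)

theorem quaternion_energies (n : ℕ) [NeZero n] (hn : 2 ≤ n) :
    (CNEnergiesEqual (QuaternionGroup n) ↔ n = 2 ∨ n = 3) ∧
      (CNEnergiesIncreasing (QuaternionGroup n) ↔ ¬ (n = 2 ∨ n = 3)) := by
  have hd := QuaternionGroup.δ_one (n := n) (by omega)
  have hg := Nat.gcd_self_sub_two (n := 2 * n) (by omega)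
  rw [Nat.gcd_two_eq_two (by omega)] at hg
  have hdiv : 2 * n / 2 = n := by omega
  rcases Nat.mod_two_eq_zero_or_one n with h | h
  · have hu : (cccGraph (QuaternionGroup n)).IsCliqueUnion (n - 1) 2 1 :=
      AbelianIndexTwo.isCliqueUnion_of_cyclic _ hd hg (by omega)
        (by rw [hdiv, Nat.gcd_comm, Nat.gcd_two_eq_two h]) rfl (by omega)
    exact energies_dichotomy (fun hP => hu.energies_eq_of_small (by omega) (by omega))
      fun hP => hu.energies_lt (by omega) (by omega) (by omega) (by omega)
  · have hu : (cccGraph (QuaternionGroup n)).IsCliqueUnion (n - 1) 1 2 :=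
      AbelianIndexTwo.isCliqueUnion_of_cyclic _ hd hg (by omega)
        (by rw [hdiv, Nat.gcd_comm, Nat.gcd_two_eq_one h]) rfl (by omega)
    exact energies_dichotomy (fun hP => hu.energies_eq_of_small (by omega) (by omega))
      fun hP => hu.energies_lt (by omega) (by omega) (by omega) (by omega)

namespace GroupFamilies

theorem semidihedral_energies (n : ℕ) [NeZero n] (hn : 2 ≤ n) :
    (CNEnergiesEqual (SD n) ↔ n = 3) ∧ (CNEnergiesIncreasing (SD n) ↔ ¬ n = 3) := by
  obtain ⟨e⟩ := exists_equivSD n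
  have hd : ((twistSD n).abelianIndexTwo e).δ 1 = (2 * (n - 1) : ℕ) := by
    rw [AbelianIndexTwo.δ_apply]
    simp [TwistData.abelianIndexTwo, twistSD, Nat.cast_sub (by omega : 1 ≤ n)]
    ring
  have hg : (4 * n).gcd (2 * (n - 1)) = 2 * (n - 1).gcd 2 := by
    rw [show 4 * n = 2 * (2 * n) by ring, Nat.gcd_mul_left]
    congr 1
    obtain ⟨k, rfl⟩ := Nat.exists_eq_add_of_le (by omega : 1 ≤ n)
    rw [Nat.add_sub_cancel_left, Nat.gcd_comm, mul_add, Nat.gcd_add_mul_right_right]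
  rcases Nat.mod_two_eq_zero_or_one n with h | h
  · rw [Nat.gcd_two_eq_one (by omega), mul_one] at hg
    have hu : (cccGraph (SD n)).IsCliqueUnion (2 * n - 1) 2 1 :=
      AbelianIndexTwo.isCliqueUnion_of_cyclic _ hd hg (by omega)
        (by rw [Nat.gcd_comm, Nat.gcd_two_eq_two (by omega)]) rfl (by omega)
    exact energies_dichotomy (fun hP => by omega)
      fun hP => hu.energies_lt (by omega) (by omega) (by omega) (by omega)
  · rw [Nat.gcd_two_eq_two (by omega)] at hg
    have hu : (cccGraph (SD n)).IsCliqueUnion (2 * n - 2) 1 4 := by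
      refine AbelianIndexTwo.isCliqueUnion_of_cyclic _ hd hg (by omega) ?_ rfl (by omega)
      rw [show 4 * n / (2 * 2) = n by omega]
      exact Nat.Coprime.mul_left (Nat.coprime_two_left.2 (Nat.odd_iff.2 h))
        (Nat.coprime_two_left.2 (Nat.odd_iff.2 h))
    refine energies_dichotomy (fun hP => ?_)
      fun hP => hu.energies_lt (by omega) (by omega) (by omega) (by omega)
    subst hP
    exact hu.energies_eq_of_eq (by omega)

/-- The first factor `⟨x²⟩` is central, so `δ` is zero on it and multiplication by `-2` on the
second. The index of `H` comes from the second factor alone, while the centre gains a factor `n`. -/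
theorem isCliqueUnionU (n m : ℕ) [NeZero n] [NeZero m] (hm : 3 ≤ m) {g p r q : ℕ}
    (hg : m.gcd 2 = g) (hr : g.gcd (m / g) = r) (hq : n * g = r * q)
    (hp : n * m = n * g + 2 * p) : (cccGraph (U n m)).IsCliqueUnion p r q := by
  obtain ⟨e⟩ := exists_equivU n m
  let f : ZMod m →+ ZMod m := -AddMonoidHom.id _ - AddMonoidHom.id _
  have hδ : ((twistU n m).abelianIndexTwo e).δ = AddMonoidHom.prodMap 0 f := by
    ext a <;> simp [TwistData.abelianIndexTwo, twistU, AbelianIndexTwo.δ, f]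
  have hf : f 1 = (m - 2 : ℕ) := by
    rw [Nat.cast_sub (by omega), ZMod.natCast_self]
    simp [f]
    ring
  have hg' := (Nat.gcd_self_sub_two (n := m) (by omega)).trans hg
  refine ((twistU n m).abelianIndexTwo e).isCliqueUnion ?_ ?_ ?_ ?_
  · intro h
    have h1 := congrArg Prod.snd (DFunLike.congr_fun (hδ.symm.trans h) (0, 1))
    simp only [AddMonoidHom.prodMap_def, AddMonoidHom.prod_apply, AddMonoidHom.comp_apply, AddMonoidHom.coe_snd,
      AddMonoidHom.zero_apply, Prod.snd_zero, hf] at h1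
    rw [ZMod.natCast_eq_zero_iff] at h1
    have := Nat.le_of_dvd (by omega) h1
    omega
  · have hH : ((twistU n m).abelianIndexTwo e).H = AddSubgroup.prod ⊤ (f.ker ⊔ f.range) := by
      rw [AbelianIndexTwo.H, hδ]
      apply le_antisymm
      · refine sup_le ?_ ?_
        · rintro a ha
          exact ⟨trivial, (le_sup_left : f.ker ≤ _) (congrArg Prod.snd ha)⟩
        · rintro _ ⟨a, rfl⟩
          exact ⟨trivial, (le_sup_right : f.range ≤ _) ⟨a.2, rfl⟩⟩
      · rintro ⟨i, j⟩ ⟨-, hj⟩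
        obtain ⟨u, hu, v, ⟨w, rfl⟩, rfl⟩ := AddSubgroup.mem_sup.1 hj
        exact AddSubgroup.mem_sup.2 ⟨(i, u), Prod.ext rfl hu, _, ⟨(0, w), rfl⟩,
          Prod.ext (add_zero i) rfl⟩
    rw [hH, AddSubgroup.index_prod, AddSubgroup.index_top, one_mul,
      ZMod.index_ker_sup_range_of_map_one f hf, hg', hr]
  · rw [hδ, AddMonoidHom.ker_prodMap, ← hq]
    rw [Nat.card_congr (AddSubgroup.prodEquiv _ _).toEquiv, Nat.card_prod,
      ZMod.card_ker_of_map_one f hf, hg']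
    simp
  · simp only [Nat.card_prod, Nat.card_zmod]
    rw [hp, hq]

theorem U_energies (n m : ℕ) [NeZero n] [NeZero m] (hn : 2 ≤ n) (hm : 3 ≤ m) :
    (CNEnergiesEqual (U n m) ↔ m = 3 ∨ m = 4 ∨ m = 6) ∧
      (CNEnergiesIncreasing (U n m) ↔ ¬ (m = 3 ∨ m = 4 ∨ m = 6)) := by
  obtain ⟨k, rfl | rfl⟩ := Nat.even_or_odd' m
  · have hg : (2 * k).gcd 2 = 2 := Nat.gcd_two_eq_two (by omega)
    have hk : 1 ≤ k := by omega
    have hp : n * (2 * k) = n * 2 + 2 * (n * (k - 1)) := by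
      obtain ⟨l, rfl⟩ := Nat.exists_eq_add_of_le hk
      rw [Nat.add_sub_cancel_left]
      ring
    have hdiv : 2 * k / 2 = k := by omega
    rcases Nat.mod_two_eq_zero_or_one k with h | h
    · have hu : (cccGraph (U n (2 * k))).IsCliqueUnion (n * (k - 1)) 2 n :=
        isCliqueUnionU n _ hm hg (by rw [hdiv, Nat.gcd_comm, Nat.gcd_two_eq_two h])
          (mul_comm _ _) hp
      refine energies_dichotomy (fun hP => ?_) fun hP => ?_
      · obtain rfl : k = 2 := by omega
        rw [show n * (2 - 1) = n by omega] at hu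
        exact hu.energies_eq_of_eq (by omega)
      · have : n * 3 ≤ n * (k - 1) := Nat.mul_le_mul_left _ (by omega)
        exact hu.energies_lt (by omega) (by omega) (by omega) (by omega)
    · have hu : (cccGraph (U n (2 * k))).IsCliqueUnion (n * (k - 1)) 1 (n * 2) :=
        isCliqueUnionU n _ hm hg (by rw [hdiv, Nat.gcd_comm, Nat.gcd_two_eq_one h])
          (one_mul _).symm hp
      refine energies_dichotomy (fun hP => ?_) fun hP => ?_
      · obtain rfl : k = 3 := by omega
        exact hu.energies_eq_of_eq (by omega)
      · have : n * 4 ≤ n * (k - 1) := Nat.mul_le_mul_left _ (by omega)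
        exact hu.energies_lt (by omega) (by omega) (by omega) (by omega)
  · have hg : (2 * k + 1).gcd 2 = 1 := Nat.gcd_two_eq_one (by omega)
    have hu : (cccGraph (U n (2 * k + 1))).IsCliqueUnion (n * k) 1 n :=
      isCliqueUnionU n _ hm hg (by simp) (by ring) (by ring)
    refine energies_dichotomy (fun hP => ?_) fun hP => ?_
    · obtain rfl : k = 1 := by omega
      rw [mul_one n] at hu
      exact hu.energies_eq_of_eq (by omega)
    · have : n * 2 ≤ n * k := Nat.mul_le_mul_left _ (by omega)
      exact hu.energies_lt (by omega) (by omega) (by omega) (by omega)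

/-- Since `δ (i, j) = (-2 i, i mod 2)`, the subgroup `H` consists of the pairs with even first entry
and so has index two. The range is cyclic of order `lcm(n, 2)`, and `hq` says that the centre has
order `2 q`. -/
theorem isCliqueUnionV (n : ℕ) [NeZero n] {p q : ℕ} (hq : 2 * n * 2 = 2 * q * n.lcm 2)
    (hp : 2 * n * 2 = 2 * q + 2 * p) : (cccGraph (V n)).IsCliqueUnion p 2 q := by
  obtain ⟨e⟩ := exists_equivV n
  let E := (twistV n).abelianIndexTwo e
  let χ : ZMod (2 * n) →+ ZMod 2 := (ZMod.castHom (dvd_mul_right 2 n) (ZMod 2)).toAddMonoidHom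
  have hδ : ∀ a, E.δ a = (-a.1 - a.1, χ a.1) := by
    intro a
    ext <;> simp [E, χ, TwistData.abelianIndexTwo, twistV, AbelianIndexTwo.δ]
  have hχ : ∀ i : ℤ, χ i = i := by intro i; simp [χ]
  have hχ1 : χ 1 = 1 := by simp [χ]
  have hn := NeZero.pos n
  have hH : E.H = (χ.comp (AddMonoidHom.fst _ (ZMod 2))).ker := by
    apply le_antisymm
    · refine sup_le ?_ ?_
      · rintro a ha
        rw [AddMonoidHom.mem_ker, hδ] at ha
        exact congrArg Prod.snd ha
      · rintro _ ⟨a, rfl⟩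
        rw [hδ, AddMonoidHom.mem_ker]
        simp
    · rintro ⟨i, j⟩ hij
      obtain ⟨i, rfl⟩ := ZMod.intCast_surjective i
      have hi : χ i = 0 := hij
      rw [hχ, ZMod.intCast_zmod_eq_zero_iff_dvd] at hi
      obtain ⟨s, rfl⟩ := hi
      -- `δ (-s, 0)` has first entry `2 s` and second entry `s` modulo two; the summand `(0, j +
      -- s)`, which is in the kernel, corrects the second.
      refine AddSubgroup.mem_sup.2 ⟨(0, j + s), ?_, E.δ (((-s : ℤ) : ZMod (2 * n)), 0), ⟨_, rfl⟩, ?_⟩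
      · rw [AddMonoidHom.mem_ker, hδ]
        simp
      · rw [hδ, hχ]
        ext
        · push_cast
          simp
          ring
        · simp [add_assoc, CharTwo.add_self_eq_zero]
  have hrange : E.δ.range = AddSubgroup.zmultiples (E.δ (1, 0)) := by
    have : E.δ.range = (E.δ.comp (AddMonoidHom.inl (ZMod (2 * n)) (ZMod 2))).range := by
      apply le_antisymm
      · rintro _ ⟨a, rfl⟩
        exact ⟨a.1, by simp [hδ]⟩
      · rintro _ ⟨a, rfl⟩
        exact ⟨_, rfl⟩
    rw [this, ZMod.range_eq_zmultiples]
    rfl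
  have hcard : Nat.card E.δ.range = n.lcm 2 := by
    have h1 : E.δ (1, 0) = (-((2 : ℕ) : ZMod (2 * n)), ((1 : ℕ) : ZMod 2)) := by
      rw [hδ]
      ext
      · push_cast; ring
      · simp [hχ1]
    rw [hrange, Nat.card_zmultiples, h1, Prod.addOrderOf_mk, addOrderOf_neg,
      ZMod.addOrderOf_coe _ (by omega), ZMod.addOrderOf_coe _ (by omega)]
    simp
  have hker : Nat.card E.δ.ker * n.lcm 2 = 2 * n * 2 := by
    rw [← hcard, ← AddSubgroup.index_ker, E.δ.ker.card_mul_index]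
    simp
  refine E.isCliqueUnion ?_ ?_ ?_ ?_
  · intro h
    have := congrArg Prod.snd ((hδ (1, 0)).symm.trans (DFunLike.congr_fun h (1, 0)))
    simp [hχ1] at this
  · rw [hH, AddSubgroup.index_ker, AddMonoidHom.range_eq_top.2]
    · simp
    · intro j
      obtain ⟨j, rfl⟩ := ZMod.intCast_surjective j
      exact ⟨((j : ZMod (2 * n)), 0), hχ j⟩
  · exact Nat.eq_of_mul_eq_mul_right (Nat.lcm_pos hn two_pos) (hker.trans hq)
  · simpa using hp

theorem V_energies (n : ℕ) [NeZero n] (hn : 2 ≤ n) :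
    (CNEnergiesEqual (V n) ↔ n = 2) ∧ (CNEnergiesIncreasing (V n) ↔ ¬ n = 2) := by
  rcases Nat.mod_two_eq_zero_or_one n with h | h
  · have hl : n.lcm 2 = n := Nat.lcm_eq_left (Nat.dvd_of_mod_eq_zero h)
    have hu : (cccGraph (V n)).IsCliqueUnion (2 * n - 2) 2 2 :=
      isCliqueUnionV n (by rw [hl]; ring) (by omega)
    exact energies_dichotomy (fun hP => hu.energies_eq_of_small (by omega) (by omega))
      fun hP => hu.energies_lt (by omega) (by omega) (by omega) (by omega)
  · have hl : n.lcm 2 = n * 2 :=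
      Nat.Coprime.lcm_eq_mul (Nat.coprime_two_right.2 (Nat.odd_iff.2 h))
    have hu : (cccGraph (V n)).IsCliqueUnion (2 * n - 1) 2 1 :=
      isCliqueUnionV n (by rw [hl]; ring) (by omega)
    -- For odd `n` there is no equality case, as `n = 2` is excluded by parity.
    exact energies_dichotomy (fun hP => by omega)
      fun hP => hu.energies_lt (by omega) (by omega) (by omega) (by omega)

end GroupFamilies
theorem mainTheorem9 :
    (∀ (n : ℕ) [NeZero n], 3 ≤ n →
      (CNEnergiesEqual (DihedralGroup n) ↔ n = 3 ∨ n = 4 ∨ n = 5 ∨ n = 6) ∧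
      (CNEnergiesIncreasing (DihedralGroup n) ↔ ¬ (n = 3 ∨ n = 4 ∨ n = 5 ∨ n = 6))) ∧
    (∀ (n : ℕ) [NeZero n], 2 ≤ n →
      (CNEnergiesEqual (QuaternionGroup n) ↔ n = 2 ∨ n = 3) ∧
      (CNEnergiesIncreasing (QuaternionGroup n) ↔ ¬ (n = 2 ∨ n = 3))) ∧
    (∀ (n : ℕ) [NeZero n], 2 ≤ n →
      CNEnergiesEqual (GroupFamilies.U6 n) ∧ ¬ CNEnergiesIncreasing (GroupFamilies.U6 n)) ∧
    (∀ (n : ℕ) [NeZero n], 2 ≤ n →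
      (CNEnergiesEqual (GroupFamilies.SD n) ↔ n = 3) ∧
      (CNEnergiesIncreasing (GroupFamilies.SD n) ↔ ¬ n = 3)) ∧
    (∀ (n : ℕ) [NeZero n], 2 ≤ n →
      (CNEnergiesEqual (GroupFamilies.V n) ↔ n = 2) ∧
      (CNEnergiesIncreasing (GroupFamilies.V n) ↔ ¬ n = 2)) ∧
    (∀ (n m : ℕ) [NeZero n] [NeZero m], 2 ≤ n → 3 ≤ m →
      (CNEnergiesEqual (GroupFamilies.U n m) ↔ m = 3 ∨ m = 4 ∨ m = 6) ∧
      (CNEnergiesIncreasing (GroupFamilies.U n m) ↔ ¬ (m = 3 ∨ m = 4 ∨ m = 6))) := by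
  exact ⟨fun n _ hn => dihedral_energies n hn, fun n _ hn => quaternion_energies n hn,
    fun n _ hn =>
      have h := GroupFamilies.U_energies n 3 hn le_rfl
      ⟨h.1.2 (.inl rfl), fun h' => h.2.1 h' (.inl rfl)⟩,
    fun n _ hn => GroupFamilies.semidihedral_energies n hn,
    fun n _ hn => GroupFamilies.V_energies n hn,
    fun n m _ _ hn hm => GroupFamilies.U_energies n m hn hm⟩
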